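/- Let $n\in\{2,3\}$ and let $\Gamma\subset\mathbb R^n$ be a compact embedded $C^2$ hypersurface (a curve in $\mathbb R^2$ or a surface in $\mathbb R^3$), with or without boundary; the boundary $\partial\Gamma$, if there is one, is $C^2$ and (for $n=3$) may have corners. That is, near each of its points $\Gamma$ is of the form $\{g=0\}$ (interior points), or $\{g=0,\ h\ge 0\}$ (end points of a curve, edges of a surface), or $\{g=0,\ h_1\ge0 \text{ and } h_2\ge 0\}$ or $\{g=0,\ (h_1\ge0\text{ or } h_2\ge0)\}$ (corners, $n=3$), with $C^2$ functions whose differentials at the point are linearly independent and where $h$, resp. $h_1,h_2$, vanish at the point. Let $P_\Gamma:\mathbb R^n\to\Gamma$ be a closest point mapping, $|P_\Gamma(x)-x|=\min_{y\in\Gamma}|y-x|$ for all $x$ (with any choice where the closest point is not unique). Let $\Sigma(x)=\sigma_1(x)$ if $n=2$ and $\Sigma(x)=\sigma_1(x)\sigma_2(x)$ if $n=3$, where $\sigma_1\ge\sigma_2\ge\dots$ are the singular values of the Jacobian matrix $P_\Gamma'(x)$, with $\Sigma(x)=0$ where $P_\Gamma$ is not differentiable. Let $\epsilon>0$ satisfy: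 * $\epsilon|\kappa|<1$ for every principal curvature $\kappa$ of $\Gamma$ at every interior point of $\Gamma$; * the tube of radius $\epsilon$ around $\Gamma$ does not overlap itself: if $p$ is an interior point of $\Gamma$, $\nu$ a unit normal of $\Gamma$ at $p$ and $|t|<\epsilon$, then $p$ is a closest point of $\Gamma$ to $p+t\nu$, i.e. $\operatorname{dist}(p+t\nu,\Gamma)=|t|$. Let $\delta_\epsilon:\mathbb R\to\mathbb R$ be an averaging kernel, i.e. integrable, zero outside $[-\epsilon,\epsilon]$, with $\int_{\mathbb R}\delta_\epsilon=1$, and let $v:\mathbb{R}^n\to\mathbb R$ be integrable on $\Gamma$ with respect to the $(n-1)$-dimensional surface measure. Then the integrand on the right-hand side below is integrable and $$\int_\Gamma v\,dS=\int_{\mathbb R^n} v(P_\Gamma(x))\,\delta_\epsilon(d(x))\,\Sigma(x)\,dx$$ in each of the following cases: 1. $d(x)=\operatorname{dist}(x,\Gamma)$ and $\delta_\epsilon$ is even; 2. $\Gamma$ has no boundary, $\Gamma=\partial\Omega$ for an open set $\Omega$ that is the interior of its closure, and $d$ is the signed distance to $\Gamma$, i.e. $d(x)=\operatorname{dist}(x,\Omega^c)$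 for $x\in\Omega$ and $d(x)=-\operatorname{dist}(x,\Omega)$ for $x\notin\Omega$. Moreover, the parts of the level sets of $d$ around boundary edges (or end points) and corners contribute nothing: $\Sigma(x)=0$ for every $x$ with $P_\Gamma(x)\in\partial\Gamma$. At every other $x$ with $\operatorname{dist}(x,\Gamma)<\epsilon$ the mapping $P_\Gamma$ is differentiable. -/

import Mathlib

open MeasureTheory Filter Topology

/-- `ℝⁿ` with its Euclidean structure. -/
abbrev Euc (n : ℕ) : Type := EuclideanSpace ℝ (Fin n)

section Hypersurfaces

variable {n : ℕ}

/-- `g` is a local `C²` defining function of the set `Γ` at `p`: near `p`, the set `Γ` is the zero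
set of `g`, and the differential of `g` at `p` does not vanish. -/
def IsDefiningFunction (Γ : Set (Euc n)) (p : Euc n) (g : Euc n → ℝ) : Prop :=
  ContDiffAt ℝ 2 g p ∧ fderiv ℝ g p ≠ 0 ∧ ∀ᶠ x in 𝓝 p, x ∈ Γ ↔ g x = 0

/-- `p` is an interior point of `Γ`: near `p`, `Γ` is an embedded `C²` hypersurface. -/
def IsInteriorPoint (Γ : Set (Euc n)) (p : Euc n) : Prop :=
  p ∈ Γ ∧ ∃ g : Euc n → ℝ, IsDefiningFunction Γ p g

/-- `p` is a regular boundary point of `Γ` (an end point of a curve, a point of a boundary edge of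
a surface): near `p`, `Γ` is the part `h ≥ 0` of a `C²` hypersurface `g = 0`, where `g` and `h`
are `C²` with independent differentials at `p`, and `h p = 0`. -/
def IsEdgePoint (Γ : Set (Euc n)) (p : Euc n) : Prop :=
  p ∈ Γ ∧ ∃ g h : Euc n → ℝ, ContDiffAt ℝ 2 g p ∧ ContDiffAt ℝ 2 h p ∧
    LinearIndependent ℝ ![fderiv ℝ g p, fderiv ℝ h p] ∧ h p = 0 ∧
    ∀ᶠ x in 𝓝 p, x ∈ Γ ↔ g x = 0 ∧ 0 ≤ h x

/-- `p` is a corner of `Γ`: near `p`, `Γ` is a sector of a `C²` hypersurface `g = 0` that is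
bounded by two `C²` edges meeting transversally at `p`, either the convex sector
`h₁ ≥ 0 and h₂ ≥ 0` or the reentrant one `h₁ ≥ 0 or h₂ ≥ 0`.
(No such point exists for `n = 2`.) -/
def IsCornerPoint (Γ : Set (Euc n)) (p : Euc n) : Prop :=
  p ∈ Γ ∧ ∃ g h₁ h₂ : Euc n → ℝ,
    ContDiffAt ℝ 2 g p ∧ ContDiffAt ℝ 2 h₁ p ∧ ContDiffAt ℝ 2 h₂ p ∧
    LinearIndependent ℝ ![fderiv ℝ g p, fderiv ℝ h₁ p, fderiv ℝ h₂ p] ∧ h₁ p = 0 ∧ h₂ p = 0 ∧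
    ((∀ᶠ x in 𝓝 p, x ∈ Γ ↔ g x = 0 ∧ (0 ≤ h₁ x ∧ 0 ≤ h₂ x)) ∨
      (∀ᶠ x in 𝓝 p, x ∈ Γ ↔ g x = 0 ∧ (0 ≤ h₁ x ∨ 0 ≤ h₂ x)))

/-- The boundary of `Γ` as a manifold: its edges and corners. -/
def hypersurfaceBoundary (Γ : Set (Euc n)) : Set (Euc n) :=
  {p | IsEdgePoint Γ p ∨ IsCornerPoint Γ p}

/-- A compact embedded `C²` hypersurface of `ℝⁿ`, with or without boundary; the boundary is `C²`
and may have corners. -/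
def IsCompactC2Hypersurface (Γ : Set (Euc n)) : Prop :=
  IsCompact Γ ∧ ∀ p ∈ Γ, IsInteriorPoint Γ p ∨ p ∈ hypersurfaceBoundary Γ

/-- `u` is a unit normal of `Γ` at the interior point `p`; the tangent space at `p` is the kernel
of the differential of a defining function. -/
def IsUnitNormal (Γ : Set (Euc n)) (p u : Euc n) : Prop :=
  p ∈ Γ ∧ ‖u‖ = 1 ∧ ∃ g : Euc n → ℝ, IsDefiningFunction Γ p g ∧
    ∀ w : Euc n, fderiv ℝ g p w = 0 → inner ℝ u w = 0

/-- `κ` is a principal curvature of `Γ` at the interior point `p`, with respect to one of the two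
unit normals: an eigenvalue of the second fundamental form, which in terms of a defining function
`g` is the restriction of `D²g(p) / |∇g(p)|` to the tangent space `ker Dg(p)`. -/
def IsPrincipalCurvature (Γ : Set (Euc n)) (p : Euc n) (κ : ℝ) : Prop :=
  p ∈ Γ ∧ ∃ g : Euc n → ℝ, IsDefiningFunction Γ p g ∧
    ∃ w : Euc n, w ≠ 0 ∧ fderiv ℝ g p w = 0 ∧
      ∀ z : Euc n, fderiv ℝ g p z = 0 →
        fderiv ℝ (fderiv ℝ g) p w z = κ * ‖fderiv ℝ g p‖ * inner ℝ w z

/-- `P` is a closest point mapping of `Γ`: `P x` is a point of `Γ` at minimal distance from `x`. -/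
def IsClosestPointMap (Γ : Set (Euc n)) (P : Euc n → Euc n) : Prop :=
  ∀ x, P x ∈ Γ ∧ ∀ y ∈ Γ, dist (P x) x ≤ dist y x

/-- The normal segments of length `ε` on both sides of `Γ` are not cut short: on the normal line
through an interior point `p`, the points at distance less than `ε` from `p` have `p` as a closest
point of `Γ`. -/
def HasNormalTube (Γ : Set (Euc n)) (ε : ℝ) : Prop :=
  ∀ p u : Euc n, IsUnitNormal Γ p u → ∀ t : ℝ, |t| < ε → Metric.infDist (p + t • u) Γ = |t|

open Classical in
/-- The signed distance to `∂Ω`, positive in `Ω`. -/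
noncomputable def domainSignedDist (Ω : Set (Euc n)) (x : Euc n) : ℝ :=
  if x ∈ Ω then Metric.infDist x Ωᶜ else -Metric.infDist x Ω

/-- The product of the first `n - 1` singular values of the Jacobian of `P` at `x` (the indices of
`LinearMap.singularValues` start at `0` and the values decrease). Where `P` is not
differentiable, `fderiv ℝ P x = 0` and the value is `0` for `2 ≤ n`. -/
noncomputable def singularProduct (P : Euc n → Euc n) (x : Euc n) : ℝ :=
  ∏ j ∈ Finset.range (n - 1), (fderiv ℝ P x).toLinearMap.singularValues j

end Hypersurfaces

/-- An averaging kernel on `ℝ` with support in `[-ε, ε]`. -/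
structure IsAveragingKernel (K : ℝ → ℝ) (ε : ℝ) : Prop where
  integrable : Integrable K
  support : ∀ t, ε < |t| → K t = 0
  integral_eq_one : ∫ t, K t = 1

/-!
The tube around `Γ` is described by normal coordinates `(p, t) ↦ p + t ν(p)`, where `p` runs through
the interior points of `Γ` and `|t| < ε`. Three facts carry the proof.

* *The singular product is a Jacobian.* The normal-tube condition makes `p` the only closest point
  of `Γ` to `p + t ν(p)` (`IsUnitNormal.eq_of_dist_le`), and the curvature condition makes normal
  coordinates a local diffeomorphism (`IsTubeChart.exists_equiv`), so that `P` is differentiable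
  there. In a graph chart `θ` of `Γ` with normals `N`, extended to the tube by
  `tubeMap z = θ(w) + t N(w)`, where `w` is the tangential and `t` the normal component of `z`, one
  has `P ∘ tubeMap = θ`. The derivative `A` of `P` kills the normal `ν` and has its range orthogonal
  to `ν`, whence the product of its largest singular values is `|det (A + ν ⊗ ν)|`
  (`prod_singularValues_eq_abs_det`). Composing with the derivative of `tubeMap` shows that the
  product of `|det D tubeMap|` with the singular product is the area element of `θ` at `w`,
  independently of `t` (`IsTubeChart.singularProduct_mul_abs_det`).

* *The tube is a product.* By the change of variables formula, the integral of the singular product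
  over the part of the tube above a small piece of `Γ` is close to the volume of a cylinder
  over a piece of the tangent plane, and the area of that piece is close to the one of the piece of
  `Γ` since `θ` is almost an isometry near the centre of the chart
  (`exists_nhds_area_comparison`). The constants of this local comparison can be taken arbitrarily
  close to `1`, and measures can be compared locally, so the map `x ↦ (P x, d x)` pushes the
  measure with density the singular product forward to the product of the area of `Γ` with the
  length on the normal segments (`map_closestPoint_distance_eq_prod`). No area formula for
  parametrized surfaces is needed. The integral formula is then Fubini's theorem
  (`integrable_and_integral_eq`). Only a chart by chart description of `d` in normal coordinates
  enters (`IsTubeDistance`): `d = |t|` for the distance, `d = ± t` for the signed distance, where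
  connectedness of the two sides of a chart makes the sign constant.

* *The boundary contributes nothing.* A differentiable map into `Γ` that meets an edge or a corner
  has its derivative tangent to the edge, or at least not onto the tangent plane of `Γ`, so its rank
  is at most `n - 2` (`singularProduct_eq_zero_of_mem_boundary`). The points of `Γ` that are not
  interior points lie locally in common zero sets of two independent functions and are a null set
  (`measure_diff_interior_eq_zero`). Finally the points at distance exactly `ε`, where the kernel
  need not vanish, are a null set (`volume_infDist_eq_inter_eq_zero`).
-/

/-! ### Singular values and independent functionals -/

section LinearAlgebra

variable {E : Type*} [NormedAddCommGroup E] [InnerProductSpace ℝ E] [FiniteDimensional ℝ E]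

open Module in
/-- If `A` kills the unit vector `N` and has its range orthogonal to `N`, then the product of its
remaining singular values is, up to sign, the determinant of the map `B` that agrees with `A` on the
hyperplane orthogonal to `N` and fixes `N`. -/
theorem prod_singularValues_eq_abs_det {m : ℕ} (hE : finrank ℝ E = m + 1)
    (A B : E →ₗ[ℝ] E) (N : E) (hN : ‖N‖ = 1) (hAN : A N = 0) (hNA : ∀ w, inner ℝ N (A w) = 0)
    (hB : ∀ w, B w = A w + inner ℝ N w • N) :
    ∏ j ∈ Finset.range m, A.singularValues j = |LinearMap.det B| := by
  have hN0 : N ≠ 0 := by rintro rfl; simp at hN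
  have hker : 1 ≤ finrank ℝ (LinearMap.ker A) := by
    rw [Nat.succ_le_iff, finrank_pos_iff_exists_ne_zero]
    exact ⟨⟨N, hAN⟩, fun h => hN0 (congrArg Subtype.val h)⟩
  have hrk := A.finrank_range_add_finrank_ker
  rw [hE] at hrk
  by_cases hlt : finrank ℝ (LinearMap.range A) < m
  · -- both sides vanish: `B` has rank at most `rank A + 1`
    rw [Finset.prod_eq_zero (Finset.mem_range.2 hlt) A.singularValues_finrank_range_self]
    have : LinearMap.det B = 0 := by
      by_contra hdet
      have hsurj : LinearMap.range B = ⊤ :=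
        (LinearMap.equivOfDetNeZero B hdet).range
      have hle : LinearMap.range B ≤ LinearMap.range A ⊔ Submodule.span ℝ {N} := by
        rintro _ ⟨w, rfl⟩
        rw [hB]
        exact Submodule.add_mem_sup ⟨w, rfl⟩
          (Submodule.smul_mem _ _ (Submodule.mem_span_singleton_self N))
      have h1 := Submodule.finrank_mono hle
      have h2 := Submodule.finrank_add_le_finrank_add_finrank (LinearMap.range A)
        (Submodule.span ℝ {N})
      rw [hsurj, finrank_top, hE] at h1
      rw [finrank_span_singleton hN0] at h2
      omega
    simp [this]
  have hk1 : finrank ℝ (LinearMap.ker A) = 1 := by omega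
  have hS := A.isSymmetric_adjoint_comp_self
  set b := hS.eigenvectorBasis hE with hb
  have hσ : A.singularValues m = 0 := by
    rw [A.singularValues_eq_zero_iff_le_finrank_range]; omega
  have hSb : ∀ i, (LinearMap.adjoint A ∘ₗ A) (b i) = (A.singularValues i ^ 2) • b i := by
    intro i
    rw [A.sq_singularValues_fin hE i]
    exact hS.apply_eigenvectorBasis hE i
  have hlast : A (b (Fin.last m)) = 0 := by
    have := hSb (Fin.last m)
    simp only [Fin.val_last, hσ] at this
    have h2 : b (Fin.last m) ∈ LinearMap.ker (LinearMap.adjoint A ∘ₗ A) := by simpa using this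
    rw [LinearMap.ker_adjoint_comp_self] at h2
    exact h2
  obtain ⟨c, hc⟩ : ∃ c : ℝ, c • N = b (Fin.last m) := by
    obtain ⟨c, hc⟩ := (finrank_eq_one_iff_of_nonzero' (⟨N, hAN⟩ : LinearMap.ker A)
      (fun h => hN0 (congrArg Subtype.val h))).1 hk1 ⟨_, hlast⟩
    exact ⟨c, by simpa using congrArg Subtype.val hc⟩
  have hcc : c * c = 1 := by
    have h1 : ‖b (Fin.last m)‖ = 1 := b.orthonormal.1 _
    rw [← hc, norm_smul, hN, mul_one, Real.norm_eq_abs] at h1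
    rw [← abs_mul_abs_self, h1, one_mul]
  have hNb : N = c • b (Fin.last m) := by rw [← hc, smul_smul, hcc, one_smul]
  -- the eigenvectors of `A* A` are eigenvectors of `B* B = A* A + N ⊗ N`, and `N` has
  -- eigenvalue `1`
  have hBB : ∀ i, (LinearMap.adjoint B ∘ₗ B) (b i) =
      (if i = Fin.last m then 1 else A.singularValues i ^ 2) • b i := by
    intro i
    refine ext_inner_right ℝ fun w => ?_
    have e1 : inner ℝ ((LinearMap.adjoint A ∘ₗ A) (b i)) w = inner ℝ (A (b i)) (A w) := by
      simp [LinearMap.adjoint_inner_left]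
    have e2 : inner ℝ ((LinearMap.adjoint B ∘ₗ B) (b i)) w
        = inner ℝ (A (b i)) (A w) + inner ℝ N (b i) * inner ℝ N w := by
      simp only [LinearMap.comp_apply, LinearMap.adjoint_inner_left, hB, inner_add_left,
        inner_add_right, inner_smul_left, inner_smul_right, hNA, real_inner_comm N (A (b i)),
        real_inner_self_eq_norm_sq, hN]
      simp [mul_comm]
    rw [e2, ← e1, hSb]
    split_ifs with hi
    · subst hi
      simp only [Fin.val_last, hσ, inner_smul_left, hNb]
      simp [← mul_assoc, hcc, b.orthonormal.1]
    · have : inner ℝ N (b i) = 0 := by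
        rw [hNb, inner_smul_left, b.orthonormal.2 (Ne.symm hi), mul_zero]
      simp [this]
  have hdet : LinearMap.det B * LinearMap.det B
      = (∏ j ∈ Finset.range m, A.singularValues j) ^ 2 := by
    have h1 : LinearMap.det (LinearMap.adjoint B ∘ₗ B) = LinearMap.det B * LinearMap.det B := by
      rw [← LinearMap.normDet_sq, LinearMap.normDet_eq_norm_det, Real.norm_eq_abs, sq_abs, sq]
      rfl
    rw [← h1, ← LinearMap.det_toMatrix b.toBasis]
    have : LinearMap.toMatrix b.toBasis b.toBasis (LinearMap.adjoint B ∘ₗ B) =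
        Matrix.diagonal (fun i => if i = Fin.last m then 1 else A.singularValues i ^ 2) := by
      ext i j
      rw [LinearMap.toMatrix_apply]
      rw [OrthonormalBasis.coe_toBasis, hBB, map_smul, ← OrthonormalBasis.coe_toBasis,
        Module.Basis.repr_self, Finsupp.smul_single, Matrix.diagonal_apply, Finsupp.single_apply]
      by_cases hij : i = j
      · subst hij; simp
      · simp [hij, Ne.symm hij]
    rw [this, Matrix.det_diagonal, Fin.prod_univ_castSucc, ← Finset.prod_pow,
      ← Fin.prod_univ_eq_prod_range (fun j => A.singularValues j ^ 2)]
    simp [Fin.castSucc_ne_last]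
  have h0 : 0 ≤ ∏ j ∈ Finset.range m, A.singularValues j :=
    Finset.prod_nonneg fun j _ => A.singularValues_nonneg j
  rw [← abs_of_nonneg h0]
  exact ((sq_eq_sq_iff_abs_eq_abs _ _).1 (by rw [sq (LinearMap.det B), hdet])).symm

omit [FiniteDimensional ℝ E] in
theorem LinearIndependent.surjective_pi {k : ℕ} {f : Fin k → E →L[ℝ] ℝ}
    (hf : LinearIndependent ℝ f) : Function.Surjective (ContinuousLinearMap.pi f) := by
  have : Function.Surjective (ContinuousLinearMap.pi f : E →ₗ[ℝ] Fin k → ℝ) := by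
    rw [← LinearMap.dualMap_injective_iff, injective_iff_map_eq_zero]
    intro φ hφ
    rw [Fintype.linearIndependent_iff] at hf
    have h0 := hf (fun i => φ (fun j => if i = j then 1 else 0)) (by
      ext w
      have h1 := LinearMap.congr_fun hφ w
      rw [LinearMap.dualMap_apply, LinearMap.pi_apply_eq_sum_univ] at h1
      simpa [mul_comm] using h1)
    refine LinearMap.ext fun v => ?_
    rw [LinearMap.pi_apply_eq_sum_univ]
    simp [h0]
  exact this

theorem LinearIndependent.finrank_ker_pi {k : ℕ} {f : Fin k → E →L[ℝ] ℝ}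
    (hf : LinearIndependent ℝ f) :
    Module.finrank ℝ (LinearMap.ker (ContinuousLinearMap.pi f : E →ₗ[ℝ] Fin k → ℝ)) + k =
      Module.finrank ℝ E := by
  have h := (ContinuousLinearMap.pi f : E →ₗ[ℝ] Fin k → ℝ).finrank_range_add_finrank_ker
  rw [LinearMap.range_eq_top.2 hf.surjective_pi, finrank_top, Module.finrank_fin_fun] at h
  omega

end LinearAlgebra

/-! ### Points above edges and corners -/

section Boundary

variable {m : ℕ} {Γ : Set (Euc (m + 1))} {P : Euc (m + 1) → Euc (m + 1)} {x : Euc (m + 1)}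

theorem singularProduct_eq_zero_of_finrank_range_lt (h : Module.finrank ℝ
    (LinearMap.range (fderiv ℝ P x).toLinearMap) < m) : singularProduct P x = 0 :=
  Finset.prod_eq_zero (Finset.mem_range.2 (by simpa using h))
    (LinearMap.singularValues_finrank_range_self _)

theorem singularProduct_eq_zero_of_not_differentiableAt (hm : 1 ≤ m)
    (h : ¬ DifferentiableAt ℝ P x) : singularProduct P x = 0 := by
  refine Finset.prod_eq_zero (i := 0) (Finset.mem_range.2 (by simp; omega)) ?_
  rw [fderiv_zero_of_not_differentiableAt h, ContinuousLinearMap.toLinearMap_zero]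
  simp

/-- A nonnegative function that vanishes at `P x` and is nonnegative along `P` near `x` has a
critical point at `x`. -/
theorem fderiv_comp_apply_eq_zero_of_nonneg (hP : DifferentiableAt ℝ P x) {h : Euc (m + 1) → ℝ}
    (hh : DifferentiableAt ℝ h (P x)) (h0 : h (P x) = 0) (hpos : ∀ᶠ y in 𝓝 x, 0 ≤ h (P y))
    (w : Euc (m + 1)) : fderiv ℝ h (P x) (fderiv ℝ P x w) = 0 := by
  have h1 : IsLocalMin (h ∘ P) x := by
    filter_upwards [hpos] with y hy
    simpa [h0] using hy
  have h2 := h1.fderiv_eq_zero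
  rw [fderiv_comp x hh hP] at h2
  simpa using congrArg (fun L => L w) h2

/-- The derivative of `P` maps into the tangent space of the edge, which has dimension `m - 1`. -/
theorem singularProduct_eq_zero_of_isEdgePoint (hm : 1 ≤ m) (hPΓ : ∀ y, P y ∈ Γ)
    (hx : IsEdgePoint Γ (P x)) : singularProduct P x = 0 := by
  by_cases hP : DifferentiableAt ℝ P x
  swap
  · exact singularProduct_eq_zero_of_not_differentiableAt hm hP
  apply singularProduct_eq_zero_of_finrank_range_lt
  obtain ⟨-, g, h, hg, hh, hli, h0, hev⟩ := hx
  have hev' := hP.continuousAt.eventually hev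
  have hfin := hli.finrank_ker_pi
  rw [finrank_euclideanSpace_fin] at hfin
  have hlt : Module.finrank ℝ (LinearMap.ker (ContinuousLinearMap.pi
      ![fderiv ℝ g (P x), fderiv ℝ h (P x)] : Euc (m + 1) →ₗ[ℝ] Fin 2 → ℝ)) < m := by omega
  refine lt_of_le_of_lt (Submodule.finrank_mono ?_) hlt
  rintro _ ⟨w, rfl⟩
  rw [LinearMap.mem_ker]
  ext i
  fin_cases i
  · exact fderiv_comp_apply_eq_zero_of_nonneg hP (hg.differentiableAt (by norm_num))
      (hev.self_of_nhds.1 (hPΓ x)).1 (hev'.mono fun y hy => (hy.1 (hPΓ y)).1.ge) w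
  · exact fderiv_comp_apply_eq_zero_of_nonneg hP (hh.differentiableAt (by norm_num))
      h0 (hev'.mono fun y hy => (hy.1 (hPΓ y)).2) w

/-- At a corner the range of the derivative of `P` is a proper subspace of the tangent plane. For a
reentrant corner this range may contain more than the tangent vectors of the edges, but not the
vectors pointing out of `Γ`. -/
theorem singularProduct_eq_zero_of_isCornerPoint (hm : 1 ≤ m) (hPΓ : ∀ y, P y ∈ Γ)
    (hx : IsCornerPoint Γ (P x)) : singularProduct P x = 0 := by
  by_cases hP : DifferentiableAt ℝ P x
  swap
  · exact singularProduct_eq_zero_of_not_differentiableAt hm hP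
  apply singularProduct_eq_zero_of_finrank_range_lt
  obtain ⟨-, g, h₁, h₂, hg, hh₁, hh₂, hli, h₁0, h₂0, hev⟩ := hx
  have hg0 : ∀ w, fderiv ℝ g (P x) (fderiv ℝ P x w) = 0 := by
    refine fderiv_comp_apply_eq_zero_of_nonneg hP (hg.differentiableAt (by norm_num)) ?_ ?_
    · rcases hev with hev | hev
      · exact (hev.self_of_nhds.1 (hPΓ x)).1
      · exact (hev.self_of_nhds.1 (hPΓ x)).1
    · rcases hev with hev | hev
      · exact (hP.continuousAt.eventually hev).mono fun y hy => (hy.1 (hPΓ y)).1.ge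
      · exact (hP.continuousAt.eventually hev).mono fun y hy => (hy.1 (hPΓ y)).1.ge
  have hor : ∀ᶠ y in 𝓝 x, 0 ≤ h₁ (P y) ∨ 0 ≤ h₂ (P y) := by
    rcases hev with hev | hev
    · exact (hP.continuousAt.eventually hev).mono fun y hy => Or.inl (hy.1 (hPΓ y)).2.1
    · exact (hP.continuousAt.eventually hev).mono fun y hy => (hy.1 (hPΓ y)).2
  -- a tangent vector pointing out of both half-planes is not in the range of the derivative
  obtain ⟨u, hu⟩ := hli.surjective_pi ![0, -1, -1]
  have hu0 : fderiv ℝ g (P x) u = 0 := congrFun hu 0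
  have hu1 : fderiv ℝ h₁ (P x) u = -1 := congrFun hu 1
  have hu2 : fderiv ℝ h₂ (P x) u = -1 := congrFun hu 2
  have hur : ∀ w, fderiv ℝ P x w ≠ u := by
    rintro w rfl
    have key : ∀ h : Euc (m + 1) → ℝ, ContDiffAt ℝ 2 h (P x) → h (P x) = 0 →
        fderiv ℝ h (P x) (fderiv ℝ P x w) = -1 →
        ∀ᶠ t : ℝ in 𝓝[>] 0, h (P (x + t • w)) < 0 := by
      intro h hh hh0 hhw
      have hγ : HasDerivAt (fun t : ℝ => x + t • w) w 0 := by
        simpa using ((hasDerivAt_id (0 : ℝ)).smul_const w).const_add x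
      have h1 : HasFDerivAt (h ∘ P) ((fderiv ℝ h (P x)).comp (fderiv ℝ P x)) (x + (0 : ℝ) • w) := by
        simpa using (hh.differentiableAt (by norm_num)).hasFDerivAt.comp x hP.hasFDerivAt
      have h2 := h1.comp_hasDerivAt (0 : ℝ) hγ
      simp only [ContinuousLinearMap.comp_apply, hhw] at h2
      have h3 := (hasDerivAt_iff_tendsto_slope.1 h2).eventually
        (gt_mem_nhds (by norm_num : (-1 : ℝ) < 0))
      have h4 : 𝓝[>] (0 : ℝ) ≤ 𝓝[≠] 0 := nhdsWithin_mono _ fun t ht => ne_of_gt ht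
      filter_upwards [h4 h3, self_mem_nhdsWithin] with t ht htpos
      have htpos' : (0 : ℝ) < t := htpos
      simp only [slope_def_field, Function.comp_apply, zero_smul, add_zero, hh0, sub_zero] at ht
      by_contra hcon
      exact absurd ht (not_lt.2 (div_nonneg (not_lt.1 hcon) htpos'.le))
    have hγ : Tendsto (fun t : ℝ => x + t • w) (𝓝[>] 0) (𝓝 x) := by
      have : Continuous fun t : ℝ => x + t • w := by fun_prop
      exact (by simpa using this.tendsto 0 : Tendsto (fun t : ℝ => x + t • w) (𝓝 0) (𝓝 x)).mono_left
        nhdsWithin_le_nhds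
    obtain ⟨t, ht1, ht2, ht3⟩ := ((key h₁ hh₁ h₁0 hu1).and
      ((key h₂ hh₂ h₂0 hu2).and (hγ.eventually hor))).exists
    rcases ht3 with h | h <;> linarith
  have hker : Module.finrank ℝ (LinearMap.ker (fderiv ℝ g (P x)).toLinearMap) = m := by
    have h1 := (fderiv ℝ g (P x)).toLinearMap.finrank_range_add_finrank_ker
    have h2 : LinearMap.range (fderiv ℝ g (P x)).toLinearMap = ⊤ := by
      apply LinearMap.range_eq_top.2
      apply LinearMap.surjective
      intro h0
      exact hli.ne_zero 0 (ContinuousLinearMap.coe_injective h0)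
    rw [h2, finrank_top, finrank_euclideanSpace_fin, Module.finrank_self] at h1
    omega
  calc Module.finrank ℝ (LinearMap.range (fderiv ℝ P x).toLinearMap)
      < Module.finrank ℝ (LinearMap.ker (fderiv ℝ g (P x)).toLinearMap) := by
        apply Submodule.finrank_lt_finrank_of_lt
        refine lt_of_le_of_ne ?_ ?_
        · rintro _ ⟨w, rfl⟩
          exact hg0 w
        · intro heq
          have : u ∈ LinearMap.range (fderiv ℝ P x).toLinearMap := by rw [heq]; exact hu0
          obtain ⟨w, hw⟩ := this
          exact hur w hw
    _ = m := hker

theorem singularProduct_eq_zero_of_mem_boundary (hm : 1 ≤ m) (hPΓ : ∀ y, P y ∈ Γ)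
    (hx : P x ∈ hypersurfaceBoundary Γ) : singularProduct P x = 0 := by
  rcases hx with hx | hx
  · exact singularProduct_eq_zero_of_isEdgePoint hm hPΓ hx
  · exact singularProduct_eq_zero_of_isCornerPoint hm hPΓ hx

end Boundary

/-! ### Volumes of cylinders -/

section Cylinder

/-- The orthogonal projection onto the hyperplane orthogonal to the unit vector `u`. -/
noncomputable def perpProj {E : Type*} [NormedAddCommGroup E] [InnerProductSpace ℝ E] (u : E) :
    E →L[ℝ] E :=
  ContinuousLinearMap.id ℝ E - (innerSL ℝ u).smulRight u

section

variable {E : Type*} [NormedAddCommGroup E] [InnerProductSpace ℝ E] {u : E}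

theorem perpProj_apply (u z : E) : perpProj u z = z - inner ℝ u z • u := by
  simp [perpProj]

theorem perpProj_add (u z : E) : perpProj u z + inner ℝ u z • u = z := by
  simp [perpProj]

theorem inner_perpProj (hu : ‖u‖ = 1) (z : E) : inner ℝ u (perpProj u z) = 0 := by
  simp [perpProj_apply, inner_sub_right, inner_smul_right, hu]

theorem perpProj_of_inner_eq_zero {z : E} (hz : inner ℝ u z = 0) : perpProj u z = z := by
  simp [perpProj_apply, hz]

theorem perpProj_smul_self (hu : ‖u‖ = 1) (t : ℝ) : perpProj u (t • u) = 0 := by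
  simp [perpProj_apply, hu]

theorem norm_perpProj_le (hu : ‖u‖ = 1) (z : E) : ‖perpProj u z‖ ≤ ‖z‖ := by
  have h : ‖z‖ * ‖z‖ = ‖perpProj u z‖ * ‖perpProj u z‖ + ‖inner ℝ u z • u‖ * ‖inner ℝ u z • u‖ := by
    conv_lhs => rw [← perpProj_add u z]
    apply norm_add_sq_eq_norm_sq_add_norm_sq_real
    rw [inner_smul_right, real_inner_comm u (perpProj u z), inner_perpProj hu, mul_zero]
  nlinarith [norm_nonneg (perpProj u z), norm_nonneg z, mul_self_nonneg ‖inner ℝ u z • u‖]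

end

variable {m : ℕ}

/-- The volume of a right cylinder is the Euclidean Hausdorff measure of its base times the length
of its axis. -/
theorem volume_cylinder {u : Euc (m + 1)} (hu : ‖u‖ = 1) {A : Set (Euc (m + 1))}
    (hA : MeasurableSet A) (hAu : ∀ a ∈ A, inner ℝ u a = 0) {C : Set ℝ} (hC : MeasurableSet C) :
    volume {z | perpProj u z ∈ A ∧ inner ℝ u z ∈ C} = μHE[m] A * volume C := by
  obtain ⟨b, hb⟩ : ∃ b : OrthonormalBasis (Fin (m + 1)) ℝ (Euc (m + 1)), b 0 = u := by
    have : Orthonormal ℝ (({0} : Set (Fin (m + 1))).domRestrict fun _ => u) := by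
      refine ⟨fun _ => hu, fun i j hij => ?_⟩
      exact absurd (Subsingleton.elim i j) hij
    obtain ⟨b, hb⟩ := this.exists_orthonormalBasis_extension_of_card_eq (by simp)
    exact ⟨b, hb 0 rfl⟩
  -- orthonormal coordinates with `u` as the first basis vector
  let Φ : Euc (m + 1) → ℝ × Euc m := fun z =>
    Prod.map id (WithLp.toLp 2)
      (MeasurableEquiv.piFinSuccAbove (fun _ => ℝ) 0 (WithLp.ofLp (b.repr z)))
  have hΦ : MeasurePreserving Φ volume volume :=
    ((MeasurePreserving.id volume).prod (PiLp.volume_preserving_toLp (Fin m))).comp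
      ((volume_preserving_piFinSuccAbove (fun _ => ℝ) 0).comp
        ((PiLp.volume_preserving_ofLp (Fin (m + 1))).comp b.measurePreserving_repr))
  let ι : Euc m → Euc (m + 1) := fun a => b.repr.symm (WithLp.toLp 2 (Fin.cons 0 a))
  have hι : Isometry ι := by
    refine b.repr.symm.isometry.comp (Isometry.of_dist_eq fun x y => ?_)
    simp [EuclideanSpace.dist_eq, Fin.sum_univ_succ]
  have hinner : ∀ z, inner ℝ u z = b.repr z 0 := fun z => by
    rw [← hb, b.repr_apply_apply]
  have hproj : ∀ z, perpProj u z = ι (Φ z).2 := by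
    intro z
    apply b.repr.injective
    simp only [ι, LinearIsometryEquiv.apply_symm_apply]
    rw [perpProj_apply, map_sub, map_smul, hinner, ← hb, b.repr_self]
    ext i
    refine Fin.cases ?_ (fun j => ?_) i
    · simp
    · simp [Φ, MeasurableEquiv.piFinSuccAbove, Fin.tail]
  have hrange : A ⊆ Set.range ι := fun a ha =>
    ⟨(Φ a).2, by rw [← hproj, perpProj_of_inner_eq_zero (hAu a ha)]⟩
  have hset : {z | perpProj u z ∈ A ∧ inner ℝ u z ∈ C} = Φ ⁻¹' (C ×ˢ (ι ⁻¹' A)) := by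
    ext z
    simp only [Set.mem_ofPred_eq, Set.mem_preimage, Set.mem_prod, hproj, hinner]
    exact and_comm
  rw [hset, hΦ.measure_preimage (hC.prod (hι.continuous.measurable hA)).nullMeasurableSet,
    Measure.volume_eq_prod, Measure.prod_prod, mul_comm,
    ← EuclideanSpace.euclideanHausdorffMeasure_eq_volume, hι.euclideanHausdorffMeasure_preimage,
    Set.inter_eq_left.2 hrange]

end Cylinder

/-! ### The boundary has no area -/

section Null

/-- Lipschitz maps do not increase the Euclidean Hausdorff measure by more than the power of the
Lipschitz constant. -/
theorem LipschitzOnWith.euclideanHausdorffMeasure_image_le {X Y : Type*} [EMetricSpace X]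
    [MeasurableSpace X] [BorelSpace X] [EMetricSpace Y] [MeasurableSpace Y] [BorelSpace Y]
    {K : NNReal} {f : X → Y} {s : Set X} (hf : LipschitzOnWith K f s) (d : ℕ) :
    μHE[d] (f '' s) ≤ (K : ENNReal) ^ d * μHE[d] s := by
  simp_rw [Measure.euclideanHausdorffMeasure_def, Measure.smul_apply, ENNReal.smul_def, smul_eq_mul]
  rw [mul_left_comm]
  gcongr
  simpa using hf.hausdorffMeasure_image_le (Nat.cast_nonneg d)

variable {m : ℕ}

/-- The common zero set of two `C¹` functions with independent differentials at a point has
codimension two, hence no hypersurface area, near this point. -/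
theorem exists_nhds_measure_zero_of_linearIndependent {p : Euc (m + 1)} {g h : Euc (m + 1) → ℝ}
    (hg : ContDiffAt ℝ 1 g p) (hh : ContDiffAt ℝ 1 h p)
    (hli : LinearIndependent ℝ ![fderiv ℝ g p, fderiv ℝ h p]) :
    ∃ V ∈ 𝓝 p, μHE[m] {x | x ∈ V ∧ g x = 0 ∧ h x = 0} = 0 := by
  set L : Euc (m + 1) →L[ℝ] Fin 2 → ℝ :=
    ContinuousLinearMap.pi ![fderiv ℝ g p, fderiv ℝ h p] with hL
  set f : Euc (m + 1) → Fin 2 → ℝ := fun x => ![g x, h x] with hf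
  have hfL : HasStrictFDerivAt f L p := by
    rw [hasStrictFDerivAt_pi']
    intro i
    fin_cases i
    · exact hg.hasStrictFDerivAt (by norm_num)
    · exact hh.hasStrictFDerivAt (by norm_num)
  let K : Submodule ℝ (Euc (m + 1)) := LinearMap.ker (L : Euc (m + 1) →ₗ[ℝ] Fin 2 → ℝ)
  let T : Euc (m + 1) →L[ℝ] (Fin 2 → ℝ) × K := L.prod K.orthogonalProjectionOnto
  obtain ⟨c, hc, hT⟩ := LinearMap.exists_antilipschitzWith
    (T : Euc (m + 1) →ₗ[ℝ] (Fin 2 → ℝ) × K) (by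
    rw [LinearMap.ker_eq_bot']
    intro x hx
    have h1 : L x = 0 := congrArg Prod.fst hx
    have h2 : K.orthogonalProjectionOnto x = 0 := congrArg Prod.snd hx
    have h3 : x ∈ K := h1
    have h4 := Submodule.orthogonalProjectionOnto_mem_subspace_eq_self (⟨x, h3⟩ : K)
    exact congrArg Subtype.val (h4.symm.trans h2))
  obtain ⟨V, hV, happ⟩ := hfL.approximates_deriv_on_nhds (c := (2 * c)⁻¹) (Or.inr (by positivity))
  refine ⟨V, hV, ?_⟩
  set Z : Set (Euc (m + 1)) := {x | x ∈ V ∧ g x = 0 ∧ h x = 0}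
  have hanti : AntilipschitzWith c (fun x : Z => K.orthogonalProjectionOnto (x : Euc (m + 1))) := by
    refine AntilipschitzWith.of_le_mul_dist fun x y => ?_
    have hd : dist (x : Euc (m + 1)) y ≤ c * dist (T x) (T y) := hT.le_mul_dist x y
    have hf0 : f x - f y = 0 := by
      ext i; fin_cases i <;> simp [hf, x.2.2.1, x.2.2.2, y.2.2.1, y.2.2.2]
    have h1 := happ x x.2.1 y y.2.1
    rw [hf0, zero_sub, norm_neg, map_sub, ← dist_eq_norm, ← dist_eq_norm] at h1
    rw [Prod.dist_eq] at hd
    rcases max_choice (dist (T x).1 (T y).1) (dist (T x).2 (T y).2) with h2 | h2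
    · rw [h2] at hd
      have h3 : dist (x : Euc (m + 1)) y ≤ c * ((2 * c)⁻¹ * dist (x : Euc (m + 1)) y) :=
        hd.trans (by gcongr; exact h1)
      have hc' : (c : ℝ) ≠ 0 := by exact_mod_cast hc.ne'
      have h4 : (c : ℝ) * ((2 * c)⁻¹ * dist (x : Euc (m + 1)) y) =
          dist (x : Euc (m + 1)) y / 2 := by
        push_cast
        field_simp
      have h5 : dist (x : Euc (m + 1)) y ≤ 0 := by
        rw [h4] at h3
        linarith
      exact h5.trans (by positivity)
    · rw [h2] at hd
      exact hd
  have hdim : dimH Z ≤ Module.finrank ℝ K := by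
    calc dimH Z = dimH (Set.univ : Set Z) := by
          rw [← (isometry_subtype_coe (s := Z)).dimH_image Set.univ, Set.image_univ,
            Subtype.range_coe]
      _ ≤ _ := hanti.le_dimH_image _
      _ ≤ dimH (Set.univ : Set K) := dimH_mono (Set.subset_univ _)
      _ = _ := Real.dimH_univ_eq_finrank K
  have hK : Module.finrank ℝ K + 2 = m + 1 := by
    have := hli.finrank_ker_pi
    rwa [finrank_euclideanSpace_fin] at this
  have hlt : dimH Z < ((m : NNReal) : ENNReal) := by
    refine hdim.trans_lt ?_
    norm_cast
    omega
  have h0 := hausdorffMeasure_of_dimH_lt hlt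
  rw [Measure.euclideanHausdorffMeasure_def, Measure.smul_apply]
  simp only [NNReal.coe_natCast] at h0
  rw [h0, smul_zero]

/-- Near an edge or a corner, the points where one of the boundary functions is positive are
interior points; the others lie in the common zero set of two independent functions. -/
theorem measure_diff_interior_eq_zero {Γ : Set (Euc (m + 1))} (hΓ : IsCompactC2Hypersurface Γ) :
    μHE[m] (Γ \ {p | IsInteriorPoint Γ p}) = 0 := by
  refine measure_null_of_locally_null _ fun p hp => ?_
  have hint : ∀ {q : Euc (m + 1)} {g : Euc (m + 1) → ℝ}, q ∈ Γ → ContDiffAt ℝ 2 g q →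
      fderiv ℝ g q ≠ 0 → (∀ᶠ x in 𝓝 q, x ∈ Γ ↔ g x = 0) → IsInteriorPoint Γ q :=
    fun hq h1 h2 h3 => ⟨hq, _, h1, h2, h3⟩
  have hreg : ∀ {g : Euc (m + 1) → ℝ}, ContDiffAt ℝ 2 g p → fderiv ℝ g p ≠ 0 →
      ∀ᶠ q in 𝓝 p, ContDiffAt ℝ 2 g q ∧ fderiv ℝ g q ≠ 0 := fun h1 h2 =>
    (h1.eventually (by norm_num)).and
      ((h1.continuousAt_fderiv (by norm_num)).eventually_ne h2)
  rcases hΓ.2 p hp.1 with h | ⟨-, g, h, hg, hh, hli, -, hev⟩ |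
      ⟨-, g, h₁, h₂, hg, hh₁, hh₂, hli, -, -, hev⟩
  · exact absurd h hp.2
  · have hev2 := hev.eventually_nhds
    have hg0 : fderiv ℝ g p ≠ 0 := hli.ne_zero 0
    obtain ⟨V, hV, hV0⟩ := exists_nhds_measure_zero_of_linearIndependent
      (hg.of_le (by norm_num)) (hh.of_le (by norm_num)) hli
    refine ⟨Γ \ {p | IsInteriorPoint Γ p} ∩
      (V ∩ {q | (ContDiffAt ℝ 2 g q ∧ fderiv ℝ g q ≠ 0) ∧ ContDiffAt ℝ 2 h q ∧
        ∀ᶠ x in 𝓝 q, x ∈ Γ ↔ g x = 0 ∧ 0 ≤ h x}),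
      inter_mem_nhdsWithin _ (inter_mem hV ((hreg hg hg0).and
        ((hh.eventually (by norm_num)).and hev2))), measure_mono_null ?_ hV0⟩
    rintro q ⟨⟨hqΓ, hqi⟩, hqV, ⟨hgq, hgq0⟩, hhq, hevq⟩
    obtain ⟨h1, h2⟩ := hevq.self_of_nhds.1 hqΓ
    refine ⟨hqV, h1, le_antisymm (not_lt.1 fun hpos => hqi ?_) h2⟩
    refine hint hqΓ hgq hgq0 ?_
    filter_upwards [hevq, hhq.continuousAt.eventually (lt_mem_nhds hpos)] with x hx hx'
    rw [hx]; exact and_iff_left hx'.le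
  · have hg0 : fderiv ℝ g p ≠ 0 := hli.ne_zero 0
    have hli1 : LinearIndependent ℝ ![fderiv ℝ g p, fderiv ℝ h₁ p] := by
      have := hli.comp ![0, 1] (by decide)
      convert this using 1
      ext i; fin_cases i <;> rfl
    have hli2 : LinearIndependent ℝ ![fderiv ℝ g p, fderiv ℝ h₂ p] := by
      have := hli.comp ![0, 2] (by decide)
      convert this using 1
      ext i; fin_cases i <;> rfl
    obtain ⟨V₁, hV₁, hV₁0⟩ := exists_nhds_measure_zero_of_linearIndependent
      (hg.of_le (by norm_num)) (hh₁.of_le (by norm_num)) hli1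
    obtain ⟨V₂, hV₂, hV₂0⟩ := exists_nhds_measure_zero_of_linearIndependent
      (hg.of_le (by norm_num)) (hh₂.of_le (by norm_num)) hli2
    have hnull := measure_union_null hV₁0 hV₂0
    have hhev := (hh₁.eventually (by norm_num)).and (hh₂.eventually (by norm_num))
    rcases hev with hev | hev
    · refine ⟨Γ \ {p | IsInteriorPoint Γ p} ∩
        ((V₁ ∩ V₂) ∩ {q | (ContDiffAt ℝ 2 g q ∧ fderiv ℝ g q ≠ 0) ∧
          (ContDiffAt ℝ 2 h₁ q ∧ ContDiffAt ℝ 2 h₂ q) ∧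
          ∀ᶠ x in 𝓝 q, x ∈ Γ ↔ g x = 0 ∧ (0 ≤ h₁ x ∧ 0 ≤ h₂ x)}),
        inter_mem_nhdsWithin _ (inter_mem (inter_mem hV₁ hV₂) ((hreg hg hg0).and
          (hhev.and hev.eventually_nhds))), measure_mono_null ?_ hnull⟩
      rintro q ⟨⟨hqΓ, hqi⟩, ⟨hqV₁, hqV₂⟩, ⟨hgq, hgq0⟩, ⟨hh₁q, hh₂q⟩, hevq⟩
      obtain ⟨h1, h2, h3⟩ := hevq.self_of_nhds.1 hqΓ
      by_contra hcon
      simp only [Set.mem_union, Set.mem_ofPred_eq, not_or] at hcon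
      have hpos₁ : 0 < h₁ q := lt_of_le_of_ne h2 fun h0 => hcon.1 ⟨hqV₁, h1, h0.symm⟩
      have hpos₂ : 0 < h₂ q := lt_of_le_of_ne h3 fun h0 => hcon.2 ⟨hqV₂, h1, h0.symm⟩
      refine hqi (hint hqΓ hgq hgq0 ?_)
      filter_upwards [hevq, hh₁q.continuousAt.eventually (lt_mem_nhds hpos₁),
        hh₂q.continuousAt.eventually (lt_mem_nhds hpos₂)] with x hx hx₁ hx₂
      rw [hx]; exact and_iff_left ⟨hx₁.le, hx₂.le⟩
    · refine ⟨Γ \ {p | IsInteriorPoint Γ p} ∩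
        ((V₁ ∩ V₂) ∩ {q | (ContDiffAt ℝ 2 g q ∧ fderiv ℝ g q ≠ 0) ∧
          (ContDiffAt ℝ 2 h₁ q ∧ ContDiffAt ℝ 2 h₂ q) ∧
          ∀ᶠ x in 𝓝 q, x ∈ Γ ↔ g x = 0 ∧ (0 ≤ h₁ x ∨ 0 ≤ h₂ x)}),
        inter_mem_nhdsWithin _ (inter_mem (inter_mem hV₁ hV₂) ((hreg hg hg0).and
          (hhev.and hev.eventually_nhds))), measure_mono_null ?_ hnull⟩
      rintro q ⟨⟨hqΓ, hqi⟩, ⟨hqV₁, hqV₂⟩, ⟨hgq, hgq0⟩, ⟨hh₁q, hh₂q⟩, hevq⟩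
      obtain ⟨h1, h23⟩ := hevq.self_of_nhds.1 hqΓ
      rcases h23 with h2 | h2
      · refine Or.inl ⟨hqV₁, h1, le_antisymm (not_lt.1 fun hpos => hqi ?_) h2⟩
        refine hint hqΓ hgq hgq0 ?_
        filter_upwards [hevq, hh₁q.continuousAt.eventually (lt_mem_nhds hpos)] with x hx hx'
        rw [hx]; exact and_iff_left (Or.inl hx'.le)
      · refine Or.inr ⟨hqV₂, h1, le_antisymm (not_lt.1 fun hpos => hqi ?_) h2⟩
        refine hint hqΓ hgq hgq0 ?_
        filter_upwards [hevq, hh₂q.continuousAt.eventually (lt_mem_nhds hpos)] with x hx hx'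
        rw [hx]; exact and_iff_left (Or.inr hx'.le)

end Null

/-! ### Unit normals and closest points -/

section Normals

variable {n : ℕ} {Γ : Set (Euc n)} {p q x u : Euc n} {g : Euc n → ℝ} {ε : ℝ}

/-- The normalized gradient of `g`: near a point where `g` is a defining function of a hypersurface,
a field of unit normals. -/
noncomputable def unitGradient (g : Euc n → ℝ) (x : Euc n) : Euc n :=
  ‖fderiv ℝ g x‖⁻¹ • gradient g x

theorem norm_gradient_eq : ‖gradient g x‖ = ‖fderiv ℝ g x‖ := by
  rw [← toDual_gradient, LinearIsometryEquiv.norm_map]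

theorem norm_unitGradient (h : fderiv ℝ g x ≠ 0) : ‖unitGradient g x‖ = 1 := by
  rw [unitGradient, norm_smul, norm_inv, norm_norm, norm_gradient_eq,
    inv_mul_cancel₀ (norm_ne_zero_iff.2 h)]

theorem inner_unitGradient (x w : Euc n) :
    inner ℝ (unitGradient g x) w = ‖fderiv ℝ g x‖⁻¹ * fderiv ℝ g x w := by
  rw [unitGradient, real_inner_smul_left, inner_gradient_left]

theorem fderiv_eq_norm_mul_inner_unitGradient (h : fderiv ℝ g x ≠ 0) (w : Euc n) :
    fderiv ℝ g x w = ‖fderiv ℝ g x‖ * inner ℝ (unitGradient g x) w := by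
  rw [inner_unitGradient, mul_inv_cancel_left₀ (norm_ne_zero_iff.2 h)]

theorem contDiffAt_gradient (hg : ContDiffAt ℝ 2 g x) : ContDiffAt ℝ 1 (gradient g) x :=
  (InnerProductSpace.toDual ℝ (Euc n)).symm.contDiff.contDiffAt.comp x
    (hg.fderiv_right (by norm_num))

theorem contDiffAt_norm_fderiv (hg : ContDiffAt ℝ 2 g x) (h : fderiv ℝ g x ≠ 0) :
    ContDiffAt ℝ 1 (fun y => ‖fderiv ℝ g y‖) x := by
  have h' : gradient g x ≠ 0 := by rwa [← norm_ne_zero_iff, norm_gradient_eq, norm_ne_zero_iff]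
  have := (contDiffAt_gradient hg).norm ℝ h'
  simpa only [norm_gradient_eq] using this

theorem contDiffAt_unitGradient (hg : ContDiffAt ℝ 2 g x) (h : fderiv ℝ g x ≠ 0) :
    ContDiffAt ℝ 1 (unitGradient g) x :=
  ((contDiffAt_norm_fderiv hg h).inv (norm_ne_zero_iff.2 h)).smul (contDiffAt_gradient hg)

theorem IsDefiningFunction.isUnitNormal (hg : IsDefiningFunction Γ p g) (hp : p ∈ Γ) :
    IsUnitNormal Γ p (unitGradient g p) :=
  ⟨hp, norm_unitGradient hg.2.1, g, hg, fun w hw => by rw [inner_unitGradient, hw, mul_zero]⟩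

theorem IsDefiningFunction.eventually (hg : IsDefiningFunction Γ p g) :
    ∀ᶠ q in 𝓝 p, IsDefiningFunction Γ q g :=
  (hg.1.eventually (by norm_num)).and
    (((hg.1.continuousAt_fderiv (by norm_num)).eventually_ne hg.2.1).and hg.2.2.eventually_nhds)

/-- The shape operator is the derivative of the normalized gradient. -/
theorem fderiv_fderiv_eq_inner_fderiv_unitGradient (hg : ContDiffAt ℝ 2 g x)
    (h : fderiv ℝ g x ≠ 0) (w : Euc n) {z : Euc n} (hz : fderiv ℝ g x z = 0) :
    fderiv ℝ (fderiv ℝ g) x w z =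
      ‖fderiv ℝ g x‖ * inner ℝ (fderiv ℝ (unitGradient g) x w) z := by
  have h1 : ContDiffAt ℝ 1 (fderiv ℝ g) x := hg.fderiv_right (by norm_num)
  have hN := contDiffAt_unitGradient hg h
  have e1 : HasFDerivAt (fun y => fderiv ℝ g y z) ((fderiv ℝ (fderiv ℝ g) x).flip z) x :=
    (h1.differentiableAt (by norm_num)).hasFDerivAt.clm_apply (hasFDerivAt_const z x)
      |>.congr_fderiv (by ext; simp)
  have e2 := ((contDiffAt_norm_fderiv hg h).differentiableAt (by norm_num)).hasFDerivAt.mul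
    ((hN.differentiableAt (by norm_num)).hasFDerivAt.inner ℝ (hasFDerivAt_const z x))
  have e3 : (fun y => fderiv ℝ g y z) =ᶠ[𝓝 x]
      (fun y => ‖fderiv ℝ g y‖) * fun y => inner ℝ (unitGradient g y) z := by
    filter_upwards [(hg.continuousAt_fderiv (by norm_num)).eventually_ne h] with y hy
    exact fderiv_eq_norm_mul_inner_unitGradient hy z
  have e4 := congrArg (fun L => L w) (e1.unique (e2.congr_of_eventuallyEq e3))
  have e5 : inner ℝ (unitGradient g x) z = 0 := by rw [inner_unitGradient, hz, mul_zero]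
  simpa [e5] using e4

/-- The curvature condition says that the differential of `p ↦ p + t N(p)` is injective on the
tangent space for `|t| < ε`. -/
theorem IsDefiningFunction.eq_zero_of_add_smul_eq_zero (hg : IsDefiningFunction Γ p g) (hp : p ∈ Γ)
    (hκ : ∀ p κ, IsPrincipalCurvature Γ p κ → ε * |κ| < 1) {t : ℝ} (ht : |t| < ε) {w : Euc n}
    (hw : fderiv ℝ g p w = 0) (h : w + t • fderiv ℝ (unitGradient g) p w = 0) : w = 0 := by
  by_contra hw0
  have ht0 : t ≠ 0 := by
    rintro rfl
    exact hw0 (by simpa using h)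
  have hpc : IsPrincipalCurvature Γ p (-t⁻¹) := by
    refine ⟨hp, g, hg, w, hw0, hw, fun z hz => ?_⟩
    have h1 : fderiv ℝ (unitGradient g) p w = (-t⁻¹) • w := by
      rw [← neg_eq_iff_add_eq_zero] at h
      rw [neg_smul, ← smul_neg, h, smul_smul, inv_mul_cancel₀ ht0, one_smul]
    rw [fderiv_fderiv_eq_inner_fderiv_unitGradient hg.1 hg.2.1 w hz, h1, real_inner_smul_left]
    ring
  have h2 := hκ p _ hpc
  rw [abs_neg, abs_inv, ← div_eq_mul_inv, div_lt_one (abs_pos.2 ht0)] at h2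
  exact lt_asymm h2 ht

/-- Differentiable maps into `Γ` have derivatives tangent to `Γ`. -/
theorem IsUnitNormal.inner_fderiv_eq_zero (hu : IsUnitNormal Γ p u) {f : Euc n → Euc n}
    {f' : Euc n →L[ℝ] Euc n} (hf : HasFDerivAt f f' x) (hx : f x = p)
    (hΓ : ∀ᶠ y in 𝓝 x, f y ∈ Γ) (v : Euc n) : inner ℝ u (f' v) = 0 := by
  obtain ⟨hp, -, g, hg, hgu⟩ := hu
  subst hx
  apply hgu
  have h1 := (hg.1.differentiableAt (by norm_num)).hasFDerivAt.comp x hf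
  have h2 : g ∘ f =ᶠ[𝓝 x] fun _ => 0 := by
    filter_upwards [hf.continuousAt.eventually hg.2.2, hΓ] with y hy hy'
    exact hy.1 hy'
  have h3 := h1.unique ((hasFDerivAt_const (0 : ℝ) x).congr_of_eventuallyEq h2)
  simpa using congrArg (fun L => L v) h3

/-- If `p` is a closest point of `Γ` to `x`, then `x` lies on the normal line through `p`. -/
theorem IsUnitNormal.exists_eq_add_smul (hu : IsUnitNormal Γ p u)
    (hx : ∀ y ∈ Γ, dist p x ≤ dist y x) : ∃ t : ℝ, x = p + t • u := by
  obtain ⟨hp, hu1, g, hg, hgu⟩ := hu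
  have hgp : g p = 0 := hg.2.2.self_of_nhds.1 hp
  -- Lagrange multipliers: `x - p` is a multiple of the gradient of `g`
  have hextr : IsLocalExtrOn (fun y => ‖y - x‖ ^ 2) {y | g y = g p} p := by
    left
    filter_upwards [nhdsWithin_le_nhds hg.2.2, self_mem_nhdsWithin] with y hy hy'
    have hyΓ : y ∈ Γ := hy.2 (hy'.trans hgp)
    have := hx y hyΓ
    rw [dist_eq_norm, dist_eq_norm] at this
    gcongr
  have hφ : HasStrictFDerivAt (fun y => ‖y - x‖ ^ 2)
      (2 • (innerSL ℝ (p - x)).comp (ContinuousLinearMap.id ℝ (Euc n))) p :=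
    (hasStrictFDerivAt_norm_sq (p - x)).comp p ((hasStrictFDerivAt_id p).sub_const x)
  obtain ⟨a, b, hab, h⟩ := hextr.exists_multipliers_of_hasStrictFDerivAt_1d
    (hg.1.hasStrictFDerivAt (by norm_num)) hφ
  have h' : ∀ w, a * fderiv ℝ g p w + b * (2 * inner ℝ (p - x) w) = 0 := fun w => by
    have := congrArg (fun L => L w) h
    simpa [inner_sub_left] using this
  have hb : b ≠ 0 := by
    rintro rfl
    have ha : a ≠ 0 := fun ha => hab (by simp [ha])
    apply hg.2.1
    ext w
    have := h' w
    simpa [ha] using this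
  refine ⟨inner ℝ u (x - p), ?_⟩
  have hw : perpProj u (x - p) = 0 := by
    have h1 : fderiv ℝ g p (perpProj u (x - p)) = 0 := by
      by_contra h0
      -- `u` is orthogonal to the kernel of the differential, hence parallel to the gradient
      have hrep : ∀ w, fderiv ℝ g p w * inner ℝ u (unitGradient g p) =
          ‖fderiv ℝ g p‖ * inner ℝ u w := by
        intro w
        have hN := norm_unitGradient hg.2.1
        have h3 := hgu (w - inner ℝ (unitGradient g p) w • unitGradient g p) (by
          rw [fderiv_eq_norm_mul_inner_unitGradient hg.2.1, inner_sub_right, inner_smul_right,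
            real_inner_self_eq_norm_sq, hN]
          ring)
        rw [inner_sub_right, inner_smul_right, sub_eq_zero] at h3
        rw [fderiv_eq_norm_mul_inner_unitGradient hg.2.1 w, h3]
        ring
      have h4 := hrep (perpProj u (x - p))
      rw [inner_perpProj hu1, mul_zero] at h4
      have h5 := hrep u
      rw [(mul_eq_zero.1 h4).resolve_left h0, mul_zero, real_inner_self_eq_norm_sq, hu1] at h5
      exact hg.2.1 (norm_eq_zero.1 (by simpa using h5.symm))
    have h2 := h' (perpProj u (x - p))
    rw [h1, mul_zero, zero_add] at h2
    have h3 : inner ℝ (p - x) (perpProj u (x - p)) = 0 := by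
      rcases mul_eq_zero.1 h2 with h | h
      · exact absurd h hb
      · linarith
    have h4 : p - x = -(perpProj u (x - p) + inner ℝ u (x - p) • u) := by
      rw [perpProj_add]; abel
    rw [h4, inner_neg_left, inner_add_left, real_inner_smul_left, inner_perpProj hu1, mul_zero,
      add_zero, neg_eq_zero, inner_self_eq_zero] at h3
    exact h3
  have h5 := perpProj_add u (x - p)
  rw [hw, zero_add] at h5
  rw [h5]; abel

/-- Inside the normal tube the closest point is unique: a second closest point `q` to `p + t u`
would be too close to the points `p + t' u` with `|t'|` slightly larger than `|t|`. -/
theorem IsUnitNormal.eq_of_dist_le (hu : IsUnitNormal Γ p u) (htube : HasNormalTube Γ ε) {t : ℝ}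
    (ht : |t| < ε) (hq : q ∈ Γ) (h : dist q (p + t • u) ≤ |t|) : q = p := by
  obtain ⟨s, hs, hst⟩ : ∃ s : ℝ, |s * t| < ε ∧ 1 < s := by
    have hc : Continuous fun s : ℝ => |s * t| := by fun_prop
    have h1 : ∀ᶠ s in 𝓝[>] (1 : ℝ), |s * t| < ε :=
      nhdsWithin_le_nhds (hc.continuousAt.eventually (gt_mem_nhds (by simpa using ht)))
    exact (h1.and self_mem_nhdsWithin).exists
  have h2 : |s * t| ≤ dist (p + (s * t) • u) q := by
    rw [← htube p u hu _ hs]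
    exact Metric.infDist_le_dist_of_mem hq
  have key : ∀ r : ℝ, ‖(q - p) - r • u‖ ^ 2 = ‖q - p‖ ^ 2 - 2 * r * inner ℝ (q - p) u + r ^ 2 := by
    intro r
    rw [norm_sub_sq_real, inner_smul_right, norm_smul, hu.2.1, mul_one, Real.norm_eq_abs, sq_abs]
    ring
  have h3 : ‖(q - p) - t • u‖ ^ 2 ≤ t ^ 2 := by
    rw [← sq_abs t]
    rw [dist_eq_norm, ← sub_sub] at h
    gcongr
  have h4 : (s * t) ^ 2 ≤ ‖(q - p) - (s * t) • u‖ ^ 2 := by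
    rw [← sq_abs (s * t)]
    rw [dist_comm, dist_eq_norm, ← sub_sub] at h2
    gcongr
  rw [key] at h3 h4
  have h5 : t * inner ℝ (q - p) u ≤ 0 := by
    by_contra hcon
    nlinarith
  have h6 : ‖q - p‖ ^ 2 ≤ 0 := by linarith
  have h7 : ‖q - p‖ = 0 := by nlinarith [norm_nonneg (q - p)]
  exact sub_eq_zero.1 (norm_eq_zero.1 h7)

variable {P : Euc n → Euc n}

theorem IsClosestPointMap.infDist_eq (hP : IsClosestPointMap Γ P) (x : Euc n) :
    Metric.infDist x Γ = dist x (P x) := by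
  refine le_antisymm (Metric.infDist_le_dist_of_mem (hP x).1) ?_
  refine (Metric.le_infDist ⟨_, (hP x).1⟩).2 fun y hy => ?_
  rw [dist_comm x, dist_comm x]
  exact (hP x).2 y hy

theorem IsUnitNormal.closestPoint_eq (hu : IsUnitNormal Γ p u) (htube : HasNormalTube Γ ε)
    (hP : IsClosestPointMap Γ P) {t : ℝ} (ht : |t| < ε) : P (p + t • u) = p := by
  refine hu.eq_of_dist_le htube ht (hP _).1 ?_
  rw [dist_comm, ← hP.infDist_eq, htube p u hu t ht]

end Normals

/-! ### Graph charts -/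

section Chart

variable {n : ℕ}

/-- A graph parametrization `θ` of the hypersurface `g = 0` near `p` over its tangent hyperplane,
with the orthogonal projection as its inverse. The map `θ` is the local inverse of the
diffeomorphism whose tangential component is the projection and whose normal component is a multiple
of `g`; it is defined on a neighbourhood of `0` in the whole space, and parametrizes the hypersurface on the
hyperplane. -/
theorem exists_graph_parametrization {p : Euc n} {g : Euc n → ℝ} (hg : ContDiffAt ℝ 2 g p)
    (h0 : fderiv ℝ g p ≠ 0) (hgp : g p = 0) :
    ∃ θ : Euc n → Euc n, ContDiffAt ℝ 1 θ 0 ∧ θ 0 = p ∧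
      HasFDerivAt θ (ContinuousLinearMap.id ℝ (Euc n)) 0 ∧
      (∀ᶠ w in 𝓝 0, inner ℝ (unitGradient g p) w = 0 →
        g (θ w) = 0 ∧ perpProj (unitGradient g p) (θ w - p) = w) ∧
      ∀ᶠ q in 𝓝 p, g q = 0 → θ (perpProj (unitGradient g p) (q - p)) = q := by
  set u := unitGradient g p with hu
  have hu1 : ‖u‖ = 1 := norm_unitGradient h0
  -- the local diffeomorphism straightening the hypersurface to the hyperplane orthogonal to `u`
  let G : Euc n → Euc n := fun x => perpProj u (x - p) + (‖fderiv ℝ g p‖⁻¹ * g x) • u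
  have hG1 : ContDiffAt ℝ 1 G p := by
    have : ContDiffAt ℝ 1 g p := hg.of_le (by norm_num)
    refine ContDiffAt.add ?_ ((contDiffAt_const.mul this).smul contDiffAt_const)
    exact (perpProj u).contDiff.contDiffAt.comp p (contDiffAt_id.sub contDiffAt_const)
  have hGd : HasFDerivAt G ((ContinuousLinearEquiv.refl ℝ (Euc n) : Euc n →L[ℝ] Euc n)) p := by
    have h1 : HasFDerivAt (fun x => perpProj u (x - p)) (perpProj u) p := by
      exact (perpProj u).hasFDerivAt.comp p ((hasFDerivAt_id p).sub_const p)
    have h2 := ((hg.differentiableAt (by norm_num)).hasFDerivAt.const_mul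
      (‖fderiv ℝ g p‖⁻¹)).smul_const u
    refine (h1.add h2).congr_fderiv ?_
    ext1 w
    have := perpProj_add u w
    rw [hu, inner_unitGradient, ← hu] at this
    simpa using this
  have hGp : G p = 0 := by simp [G, hgp]
  have hGs := hG1.hasStrictFDerivAt' hGd (by norm_num)
  refine ⟨hG1.localInverse hGd (by norm_num), ?_, ?_, ?_, ?_, ?_⟩
  · have := hG1.to_localInverse hGd (by norm_num)
    rwa [hGp] at this
  · have := hG1.localInverse_apply_image hGd (by norm_num)
    rwa [hGp] at this
  · have := hGs.to_localInverse.hasFDerivAt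
    rw [hGp] at this
    exact this
  · have := hGs.eventually_right_inverse
    rw [hGp] at this
    filter_upwards [this] with w hw hwu
    have hw' : perpProj u (hG1.localInverse hGd (by norm_num) w - p) +
      (‖fderiv ℝ g p‖⁻¹ * g (hG1.localInverse hGd (by norm_num) w)) • u = w := hw
    have h1 : g (hG1.localInverse hGd (by norm_num) w) = 0 := by
      have h2 := congrArg (fun y => inner ℝ u y) hw'
      simp only [inner_add_right, inner_perpProj hu1, inner_smul_right, hwu,
        real_inner_self_eq_norm_sq, hu1] at h2
      simpa [h0] using h2
    refine ⟨h1, ?_⟩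
    rwa [h1, mul_zero, zero_smul, add_zero] at hw'
  · filter_upwards [hGs.eventually_left_inverse] with q hq hgq
    have : G q = perpProj u (q - p) := by simp [G, hgq]
    rw [← this]
    exact hq

/-- A graph chart of the interior of `Γ` around `p`, together with its unit normals: the
hypersurface is parametrized near `p` by `w ↦ θ w` for small `w` in the hyperplane orthogonal to the
unit normal `u` at `p`, and `N w` is a unit normal at `θ w`. Both `θ` and `N` are defined on a ball
of the ambient space. -/
structure IsTubeChart (Γ : Set (Euc n)) (ε : ℝ) (p u : Euc n) (θ N : Euc n → Euc n) (r : ℝ) :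
    Prop where
  pos : 0 < r
  norm_u : ‖u‖ = 1
  zero : θ 0 = p
  normal_zero : N 0 = u
  hasFDerivAt_zero : HasFDerivAt θ (ContinuousLinearMap.id ℝ (Euc n)) 0
  contDiffAt : ∀ w ∈ Metric.ball 0 r, ContDiffAt ℝ 1 θ w
  contDiffAt_normal : ∀ w ∈ Metric.ball 0 r, ContDiffAt ℝ 1 N w
  norm_normal : ∀ w ∈ Metric.ball 0 r, ‖N w‖ = 1
  interior : ∀ w ∈ Metric.ball 0 r, inner ℝ u w = 0 → IsInteriorPoint Γ (θ w)
  normal : ∀ w ∈ Metric.ball 0 r, inner ℝ u w = 0 → IsUnitNormal Γ (θ w) (N w)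
  proj : ∀ w ∈ Metric.ball 0 r, inner ℝ u w = 0 → perpProj u (θ w - p) = w
  cover : ∀ᶠ q in 𝓝 p, q ∈ Γ → perpProj u (q - p) ∈ Metric.ball 0 r ∧ θ (perpProj u (q - p)) = q
  /-- The curvature condition at `p`: the derivative of `w ↦ θ w + t • N w` at `0` is injective on
  the hyperplane. -/
  eq_zero : ∀ t : ℝ, |t| < ε → ∀ w, inner ℝ u w = 0 → w + t • fderiv ℝ N 0 w = 0 → w = 0

theorem exists_isTubeChart {Γ : Set (Euc n)} {ε : ℝ} {p : Euc n} (hp : IsInteriorPoint Γ p)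
    (hκ : ∀ p κ, IsPrincipalCurvature Γ p κ → ε * |κ| < 1) {s : ℝ} (hs : 0 < s) :
    ∃ u θ N, ∃ r < s, IsTubeChart Γ ε p u θ N r := by
  obtain ⟨hpΓ, g, hg⟩ := hp
  have hgp : g p = 0 := hg.2.2.self_of_nhds.1 hpΓ
  obtain ⟨θ, hθ, hθ0, hθd, hgraph, hcover⟩ := exists_graph_parametrization hg.1 hg.2.1 hgp
  have hθc : Tendsto θ (𝓝 0) (𝓝 p) := by simpa [hθ0] using hθ.continuousAt.tendsto
  have hdef := hθc.eventually hg.eventually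
  obtain ⟨r₀, hr₀, hball⟩ := Metric.eventually_nhds_iff_ball.1
    (hdef.and (hgraph.and (hθ.eventually (by norm_num))))
  obtain ⟨r, hr, hrs⟩ : ∃ r, 0 < r ∧ r < min r₀ s := exists_between (lt_min hr₀ hs)
  replace hball : ∀ w ∈ Metric.ball (0 : Euc n) r, _ := fun w hw =>
    hball w (Metric.ball_subset_ball (hrs.trans_le (min_le_left _ _)).le hw)
  have hmem : ∀ w ∈ Metric.ball (0 : Euc n) r, inner ℝ (unitGradient g p) w = 0 → θ w ∈ Γ :=
    fun w hw hwu => (hball w hw).1.2.2.self_of_nhds.2 ((hball w hw).2.1 hwu).1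
  refine ⟨unitGradient g p, θ, unitGradient g ∘ θ, r, hrs.trans_le (min_le_right _ _), hr,
    norm_unitGradient hg.2.1, hθ0, by simp [hθ0], hθd, fun w hw => (hball w hw).2.2, fun w hw => ?_,
    fun w hw => norm_unitGradient (hball w hw).1.2.1,
    fun w hw hwu => ⟨hmem w hw hwu, g, (hball w hw).1⟩,
    fun w hw hwu => (hball w hw).1.isUnitNormal (hmem w hw hwu),
    fun w hw hwu => ((hball w hw).2.1 hwu).2, ?_, fun t ht w hw h => ?_⟩
  · exact (contDiffAt_unitGradient (hball w hw).1.1 (hball w hw).1.2.1).comp w (hball w hw).2.2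
  · have hc : Tendsto (fun q => perpProj (unitGradient g p) (q - p)) (𝓝 p) (𝓝 0) := by
      have : Continuous fun q => perpProj (unitGradient g p) (q - p) := by fun_prop
      simpa using this.tendsto p
    filter_upwards [hc.eventually (Metric.ball_mem_nhds 0 hr), hcover, hg.2.2] with q h1 h2 h3 h4
    exact ⟨h1, h2 (h3.1 h4)⟩
  · refine hg.eq_zero_of_add_smul_eq_zero hpΓ hκ ht ?_ ?_ (w := w)
    · rw [fderiv_eq_norm_mul_inner_unitGradient hg.2.1, hw, mul_zero]
    · have hN : DifferentiableAt ℝ (unitGradient g) (θ 0) := by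
        rw [hθ0]; exact (contDiffAt_unitGradient hg.1 hg.2.1).differentiableAt (by norm_num)
      rw [fderiv_comp 0 hN hθd.differentiableAt, hθd.fderiv, hθ0] at h
      simpa using h

end Chart

/-! ### Normal coordinates -/

section TubeMap

variable {n : ℕ} {Γ : Set (Euc n)} {ε r : ℝ} {p u : Euc n} {θ N : Euc n → Euc n} {P : Euc n → Euc n}

/-- Normal coordinates around a hypersurface with graph parametrization `θ` and normals `N`: the
component of `z` orthogonal to `u` selects the foot point, the component along `u` is the signed
distance travelled along the normal. -/
noncomputable def tubeMap (u : Euc n) (θ N : Euc n → Euc n) (z : Euc n) : Euc n :=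
  θ (perpProj u z) + inner ℝ u z • N (perpProj u z)

/-- The derivative of `tubeMap`. -/
noncomputable def tubeDeriv (u : Euc n) (θ N : Euc n → Euc n) (z : Euc n) : Euc n →L[ℝ] Euc n :=
  (fderiv ℝ θ (perpProj u z)).comp (perpProj u) +
    (inner ℝ u z • (fderiv ℝ N (perpProj u z)).comp (perpProj u) +
      (innerSL ℝ u).smulRight (N (perpProj u z)))

/-- The derivative of `tubeMap` at the point `w` of the hyperplane orthogonal to `u`. Its
determinant is the area element of the parametrization `θ`. -/
noncomputable def tubeFrame (u : Euc n) (θ N : Euc n → Euc n) (w : Euc n) : Euc n →L[ℝ] Euc n :=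
  (fderiv ℝ θ w).comp (perpProj u) + (innerSL ℝ u).smulRight (N w)

theorem tubeDeriv_apply (z ζ : Euc n) : tubeDeriv u θ N z ζ =
    fderiv ℝ θ (perpProj u z) (perpProj u ζ) +
      (inner ℝ u z • fderiv ℝ N (perpProj u z) (perpProj u ζ) +
        inner ℝ u ζ • N (perpProj u z)) := by
  simp [tubeDeriv]

theorem eventually_perpProj_mem_ball_and_abs_inner_lt {z : Euc n}
    (hz : perpProj u z ∈ Metric.ball 0 r) (ht : |inner ℝ u z| < ε) :
    ∀ᶠ y in 𝓝 z, perpProj u y ∈ Metric.ball 0 r ∧ |inner ℝ u y| < ε := by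
  have h1 : Continuous fun y => perpProj u y := by fun_prop
  have h2 : Continuous fun y => |inner ℝ u y| := by fun_prop
  exact (h1.continuousAt.eventually (Metric.isOpen_ball.mem_nhds hz)).and
    (h2.continuousAt.eventually (gt_mem_nhds ht))

namespace IsTubeChart

theorem mono (h : IsTubeChart Γ ε p u θ N r) {s : ℝ} (hs : 0 < s) (hsr : s ≤ r) :
    IsTubeChart Γ ε p u θ N s := by
  have hb : ∀ w ∈ Metric.ball (0 : Euc n) s, w ∈ Metric.ball 0 r :=
    fun w hw => Metric.ball_subset_ball hsr hw
  refine ⟨hs, h.norm_u, h.zero, h.normal_zero, h.hasFDerivAt_zero,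
    fun w hw => h.contDiffAt w (hb w hw), fun w hw => h.contDiffAt_normal w (hb w hw),
    fun w hw => h.norm_normal w (hb w hw), fun w hw => h.interior w (hb w hw),
    fun w hw => h.normal w (hb w hw), fun w hw => h.proj w (hb w hw), ?_, h.eq_zero⟩
  have hc : Tendsto (fun q => perpProj u (q - p)) (𝓝 p) (𝓝 0) := by
    have : Continuous fun q => perpProj u (q - p) := by fun_prop
    simpa using this.tendsto p
  filter_upwards [h.cover, hc.eventually (Metric.ball_mem_nhds 0 hs)] with q h1 h2 h3
  exact ⟨h2, (h1 h3).2⟩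

theorem isUnitNormal (h : IsTubeChart Γ ε p u θ N r) {z : Euc n}
    (hz : perpProj u z ∈ Metric.ball 0 r) : IsUnitNormal Γ (θ (perpProj u z)) (N (perpProj u z)) :=
  h.normal _ hz (inner_perpProj h.norm_u z)

theorem contDiffAt_tubeMap (h : IsTubeChart Γ ε p u θ N r) {z : Euc n}
    (hz : perpProj u z ∈ Metric.ball 0 r) : ContDiffAt ℝ 1 (tubeMap u θ N) z := by
  have hπ : ContDiffAt ℝ 1 (perpProj u) z := (perpProj u).contDiff.contDiffAt
  exact ((h.contDiffAt _ hz).comp z hπ).add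
    ((innerSL ℝ u).contDiff.contDiffAt.smul ((h.contDiffAt_normal _ hz).comp z hπ))

theorem hasFDerivAt_tubeMap (h : IsTubeChart Γ ε p u θ N r) {z : Euc n}
    (hz : perpProj u z ∈ Metric.ball 0 r) :
    HasFDerivAt (tubeMap u θ N) (tubeDeriv u θ N z) z := by
  have h1 := ((h.contDiffAt _ hz).differentiableAt (by norm_num)).hasFDerivAt.comp z
    (perpProj u).hasFDerivAt
  have h2 := ((h.contDiffAt_normal _ hz).differentiableAt (by norm_num)).hasFDerivAt.comp z
    (perpProj u).hasFDerivAt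
  exact h1.add ((innerSL ℝ u).hasFDerivAt.smul h2)

theorem closestPoint_tubeMap (h : IsTubeChart Γ ε p u θ N r) (htube : HasNormalTube Γ ε)
    (hP : IsClosestPointMap Γ P) {z : Euc n} (hz : perpProj u z ∈ Metric.ball 0 r)
    (ht : |inner ℝ u z| < ε) : P (tubeMap u θ N z) = θ (perpProj u z) :=
  (h.isUnitNormal hz).closestPoint_eq htube hP ht

theorem infDist_tubeMap (h : IsTubeChart Γ ε p u θ N r) (htube : HasNormalTube Γ ε) {z : Euc n}
    (hz : perpProj u z ∈ Metric.ball 0 r) (ht : |inner ℝ u z| < ε) :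
    Metric.infDist (tubeMap u θ N z) Γ = |inner ℝ u z| :=
  htube _ _ (h.isUnitNormal hz) _ ht

theorem exists_tubeMap_eq (h : IsTubeChart Γ ε p u θ N r) (hP : IsClosestPointMap Γ P)
    {w : Euc n} (hw : w ∈ Metric.ball 0 r) (hwu : inner ℝ u w = 0) {x : Euc n} (hx : P x = θ w) :
    ∃ z, perpProj u z = w ∧ tubeMap u θ N z = x ∧ |inner ℝ u z| = Metric.infDist x Γ := by
  obtain ⟨t, ht⟩ := (h.normal w hw hwu).exists_eq_add_smul (x := x) (by rw [← hx]; exact (hP x).2)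
  have h1 : perpProj u (w + t • u) = w := by
    rw [map_add, perpProj_smul_self h.norm_u, perpProj_of_inner_eq_zero hwu, add_zero]
  have h2 : inner ℝ u (w + t • u) = t := by
    rw [inner_add_right, hwu, inner_smul_right, real_inner_self_eq_norm_sq, h.norm_u]; ring
  refine ⟨w + t • u, h1, by rw [tubeMap, h1, h2, ← ht], ?_⟩
  rw [h2, hP.infDist_eq, hx, dist_eq_norm, ht, add_sub_cancel_left, norm_smul, h.norm_normal w hw,
    mul_one, Real.norm_eq_abs]

theorem inner_fderiv_normal (h : IsTubeChart Γ ε p u θ N r) {w : Euc n}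
    (hw : w ∈ Metric.ball 0 r) (ζ : Euc n) : inner ℝ (N w) (fderiv ℝ N w ζ) = 0 := by
  have h1 := ((h.contDiffAt_normal w hw).differentiableAt (by norm_num)).hasFDerivAt
  have h2 := h1.inner ℝ h1
  have h3 : (fun y => inner ℝ (N y) (N y)) =ᶠ[𝓝 w] fun _ => (1 : ℝ) := by
    filter_upwards [Metric.isOpen_ball.mem_nhds hw] with y hy
    rw [real_inner_self_eq_norm_sq, h.norm_normal y hy, one_pow]
  have h4 := congrArg (fun L => L ζ)
    (h2.unique ((hasFDerivAt_const (1 : ℝ) w).congr_of_eventuallyEq h3))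
  have h5 : inner ℝ (N w) (fderiv ℝ N w ζ) + inner ℝ (fderiv ℝ N w ζ) (N w) = 0 := by
    simpa using h4
  rw [real_inner_comm] at h5
  rw [real_inner_comm]
  linarith

theorem ball_zero_mem (h : IsTubeChart Γ ε p u θ N r) (t : ℝ) :
    perpProj u (t • u) ∈ Metric.ball 0 r := by
  rw [perpProj_smul_self h.norm_u]
  exact Metric.mem_ball_self h.pos

/-- On the normal line through the centre of the chart the tube map is a local diffeomorphism. -/
theorem exists_equiv (h : IsTubeChart Γ ε p u θ N r) {t : ℝ} (ht : |t| < ε) :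
    ∃ e : Euc n ≃L[ℝ] Euc n, HasStrictFDerivAt (tubeMap u θ N) (e : Euc n →L[ℝ] Euc n) (t • u) := by
  have hin : inner ℝ u (t • u) = t := by
    rw [inner_smul_right, real_inner_self_eq_norm_sq, h.norm_u]; ring
  have hd := h.hasFDerivAt_tubeMap (h.ball_zero_mem t)
  have hinj : Function.Injective (tubeDeriv u θ N (t • u)) := by
    rw [injective_iff_map_eq_zero]
    intro ζ hζ
    rw [tubeDeriv_apply, perpProj_smul_self h.norm_u, hin, h.hasFDerivAt_zero.fderiv,
      h.normal_zero] at hζ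
    have hN : inner ℝ u (fderiv ℝ N 0 (perpProj u ζ)) = 0 := by
      have := h.inner_fderiv_normal (Metric.mem_ball_self h.pos) (perpProj u ζ)
      rwa [h.normal_zero] at this
    have h1 := congrArg (fun y => inner ℝ u y) hζ
    simp only [inner_add_right, inner_smul_right, hN, ContinuousLinearMap.id_apply,
      inner_perpProj h.norm_u, real_inner_self_eq_norm_sq, h.norm_u, inner_zero_right] at h1
    have h2 : inner ℝ u ζ = 0 := by linarith
    rw [h2, zero_smul, add_zero, ContinuousLinearMap.id_apply] at hζ
    have h3 := h.eq_zero t ht _ (inner_perpProj h.norm_u ζ) hζ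
    rwa [perpProj_of_inner_eq_zero h2] at h3
  let e := (LinearEquiv.ofInjectiveEndo (tubeDeriv u θ N (t • u)).toLinearMap hinj
    ).toContinuousLinearEquiv
  have he : (e : Euc n →L[ℝ] Euc n) = tubeDeriv u θ N (t • u) := by
    ext1 ζ
    rfl
  refine ⟨e, ?_⟩
  rw [he]
  exact (h.contDiffAt_tubeMap (h.ball_zero_mem t)).hasStrictFDerivAt' hd (by norm_num)

theorem differentiableAt_closestPoint (h : IsTubeChart Γ ε p u θ N r) (htube : HasNormalTube Γ ε)
    (hP : IsClosestPointMap Γ P) {x : Euc n} (hx : P x = p) (hd : Metric.infDist x Γ < ε) :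
    DifferentiableAt ℝ P x := by
  obtain ⟨z, hz, rfl, hzt⟩ := h.exists_tubeMap_eq hP (Metric.mem_ball_self h.pos)
    (inner_zero_right u) (by rw [hx, h.zero])
  rw [← hzt] at hd
  obtain ⟨t, rfl⟩ : ∃ t : ℝ, t • u = z :=
    ⟨inner ℝ u z, by have := perpProj_add u z; rwa [hz, zero_add] at this⟩
  have hin : inner ℝ u (t • u) = t := by
    rw [inner_smul_right, real_inner_self_eq_norm_sq, h.norm_u]; ring
  rw [hin] at hd
  obtain ⟨e, he⟩ := h.exists_equiv hd
  have hdom : ∀ᶠ y in 𝓝 (t • u), perpProj u y ∈ Metric.ball 0 r ∧ |inner ℝ u y| < ε :=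
    eventually_perpProj_mem_ball_and_abs_inner_lt (h.ball_zero_mem t) (by rwa [hin])
  have heq : P =ᶠ[𝓝 (tubeMap u θ N (t • u))]
      fun y => θ (perpProj u (he.localInverse _ _ _ y)) := by
    filter_upwards [he.eventually_right_inverse, he.localInverse_tendsto.eventually hdom]
      with y hy hy'
    conv_lhs => rw [← hy]
    exact h.closestPoint_tubeMap htube hP hy'.1 hy'.2
  refine DifferentiableAt.congr_of_eventuallyEq ?_ heq
  have hinv := he.to_localInverse.hasFDerivAt.differentiableAt
  have h1 : DifferentiableAt ℝ (fun y => perpProj u (he.localInverse _ _ _ y))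
      (tubeMap u θ N (t • u)) := (perpProj u).differentiableAt.comp _ hinv
  refine DifferentiableAt.comp (g := θ) _ ?_ h1
  rw [he.localInverse_apply_image, perpProj_smul_self h.norm_u]
  exact h.hasFDerivAt_zero.differentiableAt

theorem continuousAt_tubeFrame (h : IsTubeChart Γ ε p u θ N r) :
    ContinuousAt (tubeFrame u θ N) 0 := by
  have h1 : ContinuousAt (fderiv ℝ θ) 0 :=
    (h.contDiffAt 0 (Metric.mem_ball_self h.pos)).continuousAt_fderiv (by norm_num)
  have h2 : ContinuousAt N 0 := (h.contDiffAt_normal 0 (Metric.mem_ball_self h.pos)).continuousAt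
  refine (h1.clm_comp continuousAt_const).add ?_
  exact (ContinuousLinearMap.smulRightL ℝ (Euc n) (Euc n)
    (innerSL ℝ u)).continuous.continuousAt.comp h2

theorem tubeFrame_zero (h : IsTubeChart Γ ε p u θ N r) :
    tubeFrame u θ N 0 = ContinuousLinearMap.id ℝ (Euc n) := by
  ext1 ζ
  simp [tubeFrame, h.hasFDerivAt_zero.fderiv, h.normal_zero, perpProj_add]

end IsTubeChart

end TubeMap

section Jacobian

variable {m : ℕ} {Γ : Set (Euc (m + 1))} {ε r : ℝ} {p u : Euc (m + 1)}
  {θ N P : Euc (m + 1) → Euc (m + 1)}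

/-- The singular values of the closest point map compensate the Jacobian of the normal coordinates:
what remains is the area element at the foot point. -/
theorem IsTubeChart.singularProduct_mul_abs_det (h : IsTubeChart Γ ε p u θ N r)
    (htube : HasNormalTube Γ ε) (hP : IsClosestPointMap Γ P) {z : Euc (m + 1)}
    (hz : perpProj u z ∈ Metric.ball 0 r) (ht : |inner ℝ u z| < ε)
    (hPd : DifferentiableAt ℝ P (tubeMap u θ N z)) :
    |(tubeDeriv u θ N z).det| * singularProduct P (tubeMap u θ N z) =
      |(tubeFrame u θ N (perpProj u z)).det| := by
  set A := fderiv ℝ P (tubeMap u θ N z) with hA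
  set ν := N (perpProj u z) with hν
  have hPz := h.closestPoint_tubeMap htube hP hz ht
  have hun := h.isUnitNormal hz
  have hθπ : HasFDerivAt (fun y => θ (perpProj u y))
      ((fderiv ℝ θ (perpProj u z)).comp (perpProj u)) z :=
    ((h.contDiffAt _ hz).differentiableAt (by norm_num)).hasFDerivAt.comp z
      (perpProj u).hasFDerivAt
  have hdom := eventually_perpProj_mem_ball_and_abs_inner_lt hz ht
  -- the chain rule for `P ∘ tubeMap = θ ∘ perpProj`
  have hchain : ∀ ζ, A (tubeDeriv u θ N z ζ) = fderiv ℝ θ (perpProj u z) (perpProj u ζ) := by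
    have h1 := hPd.hasFDerivAt.comp z (h.hasFDerivAt_tubeMap hz)
    have h2 : P ∘ tubeMap u θ N =ᶠ[𝓝 z] fun y => θ (perpProj u y) := by
      filter_upwards [hdom] with y hy
      exact h.closestPoint_tubeMap htube hP hy.1 hy.2
    intro ζ
    exact congrArg (fun L => L ζ) (h1.unique (hθπ.congr_of_eventuallyEq h2))
  have hAν : A ν = 0 := by
    have h1 : perpProj u u = 0 := by simpa using perpProj_smul_self h.norm_u 1
    have h2 := hchain u
    rw [tubeDeriv_apply, h1, real_inner_self_eq_norm_sq, h.norm_u] at h2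
    simpa using h2
  have hνA : ∀ w, inner ℝ ν (A w) = 0 :=
    hun.inner_fderiv_eq_zero hPd.hasFDerivAt hPz (Eventually.of_forall fun y => (hP y).1)
  have hνθ : ∀ ζ, inner ℝ ν (fderiv ℝ θ (perpProj u z) (perpProj u ζ)) = 0 := by
    refine hun.inner_fderiv_eq_zero hθπ rfl ?_
    filter_upwards [hdom] with y hy
    exact (h.isUnitNormal hy.1).1
  set B := A + (innerSL ℝ ν).smulRight ν with hB
  have hsing : singularProduct P (tubeMap u θ N z) = |B.det| :=
    prod_singularValues_eq_abs_det (by simp) A.toLinearMap B.toLinearMap ν hun.2.1 hAν hνA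
      (fun w => by simp [hB])
  have hcomp : tubeFrame u θ N (perpProj u z) = B.comp (tubeDeriv u θ N z) := by
    ext1 ζ
    have h1 : inner ℝ ν (tubeDeriv u θ N z ζ) = inner ℝ u ζ := by
      rw [tubeDeriv_apply, inner_add_right, hνθ, inner_add_right, inner_smul_right,
        h.inner_fderiv_normal hz, inner_smul_right, real_inner_self_eq_norm_sq, hun.2.1]
      ring
    simp [hB, tubeFrame, hchain, h1]
    rfl
  have hdet : (B.comp (tubeDeriv u θ N z)).det = B.det * (tubeDeriv u θ N z).det :=
    LinearMap.det_comp B.toLinearMap (tubeDeriv u θ N z).toLinearMap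
  rw [hcomp, hdet, hsing, abs_mul, mul_comm]

end Jacobian

/-! ### Local comparison of measures -/

section General

/-- Comparison of measures is a local matter: if `μ ≤ c ν` near every point of a set that carries
`μ`, then `μ ≤ c ν`. -/
theorem MeasureTheory.Measure.le_mul_of_locally_le {X : Type*} [TopologicalSpace X]
    [SecondCountableTopology X] [MeasurableSpace X] [BorelSpace X] {μ ν : Measure X} {c : ENNReal}
    {s : Set X} (hs : μ sᶜ = 0)
    (h : ∀ x ∈ s, ∃ V ∈ 𝓝 x, ∀ B ⊆ V, MeasurableSet B → μ B ≤ c * ν B) {B : Set X}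
    (hB : MeasurableSet B) : μ B ≤ c * ν B := by
  choose! V hV hVB using h
  obtain ⟨t, hts, htc, hcov⟩ := TopologicalSpace.countable_cover_nhdsWithin (s := s)
    (f := fun x => interior (V x)) fun x hx =>
      mem_nhdsWithin_of_mem_nhds (interior_mem_nhds.2 (hV x hx))
  rcases t.eq_empty_or_nonempty with rfl | hne
  · have : s = ∅ := by simpa using hcov
    have h0 : μ Set.univ = 0 := by simpa [this] using hs
    rw [measure_mono_null (Set.subset_univ B) h0]
    exact zero_le
  obtain ⟨e, rfl⟩ := htc.exists_eq_range hne
  set D : ℕ → Set X := disjointed fun i => interior (V (e i)) with hD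
  have hDm : ∀ i, MeasurableSet (D i) :=
    MeasurableSet.disjointed fun i => isOpen_interior.measurableSet
  have hDU : ⋃ i, D i = ⋃ i, interior (V (e i)) := iUnion_disjointed
  have hdisj : Pairwise (Function.onFun Disjoint fun i => B ∩ D i) := fun i j hij =>
    (disjoint_disjointed _ hij).mono Set.inter_subset_right Set.inter_subset_right
  have hle : ∀ i, μ (B ∩ D i) ≤ c * ν (B ∩ D i) := fun i =>
    hVB (e i) (hts ⟨i, rfl⟩) _ (Set.inter_subset_right.trans
      ((disjointed_subset _ i).trans interior_subset)) (hB.inter (hDm i))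
  calc μ B ≤ μ ((⋃ i, B ∩ D i) ∪ sᶜ) := by
        refine measure_mono fun x hx => ?_
        by_cases hxs : x ∈ s
        · left
          rw [← Set.inter_iUnion, hDU]
          refine ⟨hx, ?_⟩
          simpa using hcov hxs
        · exact Or.inr hxs
    _ ≤ μ (⋃ i, B ∩ D i) + μ sᶜ := measure_union_le _ _
    _ = ∑' i, μ (B ∩ D i) := by
        rw [hs, add_zero, measure_iUnion hdisj fun i => hB.inter (hDm i)]
    _ ≤ ∑' i, c * ν (B ∩ D i) := ENNReal.tsum_le_tsum hle
    _ = c * ν (⋃ i, B ∩ D i) := by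
        rw [ENNReal.tsum_mul_left, measure_iUnion hdisj fun i => hB.inter (hDm i)]
    _ ≤ c * ν B := by
        gcongr
        exact Set.iUnion_subset fun i => Set.inter_subset_left

theorem MeasureTheory.sigmaFinite_of_locally_finite {X : Type*} [TopologicalSpace X]
    [SecondCountableTopology X] [MeasurableSpace X] {μ : Measure X}
    {s : Set X} (hs : μ sᶜ = 0) (h : ∀ x ∈ s, ∃ V ∈ 𝓝 x, μ V < ⊤) : SigmaFinite μ := by
  choose! V hV hVf using h
  obtain ⟨t, hts, htc, hcov⟩ := TopologicalSpace.countable_cover_nhdsWithin (s := s)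
    (f := V) fun x hx => mem_nhdsWithin_of_mem_nhds (hV x hx)
  refine Measure.sigmaFinite_of_countable (S := insert sᶜ (V '' t))
    ((htc.image V).insert _) ?_ ?_
  · rintro _ (rfl | ⟨x, hx, rfl⟩)
    · simp [hs]
    · exact hVf x (hts hx)
  · rw [Set.sUnion_insert, Set.sUnion_image, Set.eq_univ_iff_forall]
    intro x
    by_cases hxs : x ∈ s
    · exact Or.inr (hcov hxs)
    · exact Or.inl hxs

theorem ENNReal.le_of_forall_one_lt_le_pow_mul {a b : ENNReal} (k : ℕ)
    (h : ∀ K : NNReal, 1 < K → a ≤ (K : ENNReal) ^ k * b) : a ≤ b := by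
  have h1 : Tendsto (fun K : NNReal => (K : ENNReal) ^ k * b) (𝓝[>] 1) (𝓝 (1 * b)) := by
    refine ENNReal.Tendsto.mul_const ?_ (Or.inl one_ne_zero)
    have : Continuous fun K : NNReal => (K : ENNReal) ^ k :=
      (ENNReal.continuous_pow k).comp ENNReal.continuous_coe
    simpa using (this.tendsto 1).mono_left nhdsWithin_le_nhds
  rw [one_mul] at h1
  exact ge_of_tendsto h1 (by filter_upwards [self_mem_nhdsWithin] with K hK using h K hK)

end General

/-! ### The tube over the interior of the hypersurface -/

section Tube

variable {n : ℕ} {Γ : Set (Euc n)} {ε : ℝ} {P : Euc n → Euc n}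

theorem exists_isOpen_inter_eq_interior (Γ : Set (Euc n)) :
    ∃ O, IsOpen O ∧ {p | IsInteriorPoint Γ p} = Γ ∩ O :=
  ⟨{p | ∃ g, IsDefiningFunction Γ p g}, isOpen_iff_mem_nhds.2 fun _ ⟨g, hg⟩ =>
    hg.eventually.mono fun _ hq => ⟨g, hq⟩, rfl⟩

theorem differentiableAt_closestPoint (htube : HasNormalTube Γ ε)
    (hκ : ∀ p κ, IsPrincipalCurvature Γ p κ → ε * |κ| < 1) (hP : IsClosestPointMap Γ P) {x : Euc n}
    (hx : IsInteriorPoint Γ (P x)) (hd : Metric.infDist x Γ < ε) : DifferentiableAt ℝ P x := by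
  obtain ⟨u, θ, N, r, -, h⟩ := exists_isTubeChart hx hκ one_pos
  exact h.differentiableAt_closestPoint htube hP rfl hd

/-- The points at distance less than `ε` whose closest point is an interior point of `Γ`. -/
def interiorTube (Γ : Set (Euc n)) (ε : ℝ) (P : Euc n → Euc n) : Set (Euc n) :=
  {x | Metric.infDist x Γ < ε ∧ IsInteriorPoint Γ (P x)}

theorem isOpen_interiorTube (htube : HasNormalTube Γ ε)
    (hκ : ∀ p κ, IsPrincipalCurvature Γ p κ → ε * |κ| < 1) (hP : IsClosestPointMap Γ P) :
    IsOpen (interiorTube Γ ε P) := by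
  obtain ⟨O, hO, hΓO⟩ := exists_isOpen_inter_eq_interior Γ
  refine isOpen_iff_mem_nhds.2 fun x ⟨hx, hxi⟩ => ?_
  have hc := (differentiableAt_closestPoint htube hκ hP hxi hx).continuousAt
  have hxO : P x ∈ Γ ∩ O := by rw [← hΓO]; exact hxi
  filter_upwards [(Metric.continuous_infDist_pt Γ).continuousAt.eventually (gt_mem_nhds hx),
    hc.eventually (hO.mem_nhds hxO.2)] with y hy hyO
  refine ⟨hy, ?_⟩
  have : P y ∈ {p | IsInteriorPoint Γ p} := by rw [hΓO]; exact ⟨(hP y).1, hyO⟩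
  exact this

theorem continuousOn_closestPoint (htube : HasNormalTube Γ ε)
    (hκ : ∀ p κ, IsPrincipalCurvature Γ p κ → ε * |κ| < 1) (hP : IsClosestPointMap Γ P) :
    ContinuousOn P (interiorTube Γ ε P) := fun _ hx =>
  (differentiableAt_closestPoint htube hκ hP hx.2 hx.1).continuousAt.continuousWithinAt

end Tube

/-! ### Area of the hypersurface and volume of the tube -/

section Area

variable {m : ℕ} {Γ : Set (Euc (m + 1))} {ε r : ℝ} {p u : Euc (m + 1)}
  {θ N P : Euc (m + 1) → Euc (m + 1)}

/-- In a chart, the singular product is a quotient of determinants, which is how its measurability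
is obtained. -/
theorem continuousAt_singularProduct (htube : HasNormalTube Γ ε)
    (hκ : ∀ p κ, IsPrincipalCurvature Γ p κ → ε * |κ| < 1) (hP : IsClosestPointMap Γ P)
    {x : Euc (m + 1)} (hx : x ∈ interiorTube Γ ε P) : ContinuousAt (singularProduct P) x := by
  obtain ⟨u, θ, N, r, -, h⟩ := exists_isTubeChart hx.2 hκ one_pos
  obtain ⟨z, hz, hzx, hzt⟩ := h.exists_tubeMap_eq hP (Metric.mem_ball_self h.pos)
    (inner_zero_right u) h.zero.symm
  have hd : |inner ℝ u z| < ε := hzt.trans_lt hx.1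
  have hzb : perpProj u z ∈ Metric.ball 0 r := by rw [hz]; exact Metric.mem_ball_self h.pos
  have hzu : inner ℝ u z • u = z := by have := perpProj_add u z; rwa [hz, zero_add] at this
  obtain ⟨e, he⟩ := h.exists_equiv hd
  rw [hzu] at he
  have hCD := h.contDiffAt_tubeMap hzb
  have hquot : singularProduct P ∘ tubeMap u θ N =ᶠ[𝓝 z] fun y =>
      |(tubeFrame u θ N (perpProj u y)).det| / |(fderiv ℝ (tubeMap u θ N) y).det| := by
    have hdet : ∀ᶠ y in 𝓝 z, (fderiv ℝ (tubeMap u θ N) y).det ≠ 0 := by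
      have hc : ContinuousAt (fun y => (fderiv ℝ (tubeMap u θ N) y).det) z :=
        ContinuousLinearMap.continuous_det.continuousAt.comp (hCD.continuousAt_fderiv (by norm_num))
      refine hc.eventually_ne ?_
      rw [he.hasFDerivAt.fderiv]
      exact (LinearEquiv.isUnit_det' e.toLinearEquiv).ne_zero
    have hU : ∀ᶠ y in 𝓝 z, tubeMap u θ N y ∈ interiorTube Γ ε P := by
      refine hCD.continuousAt.eventually ((isOpen_interiorTube htube hκ hP).mem_nhds ?_)
      rwa [hzx]
    filter_upwards [hdet, hU, eventually_perpProj_mem_ball_and_abs_inner_lt hzb hd]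
      with y hy hyU hyd
    rw [Function.comp_apply, eq_div_iff (abs_ne_zero.2 hy),
      (h.hasFDerivAt_tubeMap hyd.1).fderiv, mul_comm]
    exact h.singularProduct_mul_abs_det htube hP hyd.1 hyd.2
      (differentiableAt_closestPoint htube hκ hP hyU.2 hyU.1)
  have hcont : ContinuousAt (fun y =>
      |(tubeFrame u θ N (perpProj u y)).det| / |(fderiv ℝ (tubeMap u θ N) y).det|) z := by
    have h1 : ContinuousAt (fun y => tubeFrame u θ N (perpProj u y)) z := by
      refine ContinuousAt.comp (g := tubeFrame u θ N) ?_ (perpProj u).continuous.continuousAt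
      rw [hz]
      exact h.continuousAt_tubeFrame
    refine ContinuousAt.div ?_ ?_ ?_
    · exact (ContinuousLinearMap.continuous_det.continuousAt.comp h1).abs
    · exact (ContinuousLinearMap.continuous_det.continuousAt.comp
        (hCD.continuousAt_fderiv (by norm_num))).abs
    · rw [he.hasFDerivAt.fderiv]
      exact abs_ne_zero.2 (LinearEquiv.isUnit_det' e.toLinearEquiv).ne_zero
  have h2 := hcont.congr hquot.symm
  rw [ContinuousAt, Function.comp_apply, hzx] at h2
  rw [ContinuousAt, ← hzx, ← he.map_nhds_eq_of_equiv, hzx]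
  exact tendsto_map'_iff.2 h2

theorem IsTubeChart.measurableSet_base (h : IsTubeChart Γ ε p u θ N r) {B : Set (Euc (m + 1))}
    (hB : MeasurableSet B) :
    MeasurableSet {w | w ∈ Metric.ball 0 r ∧ inner ℝ u w = 0 ∧ θ w ∈ B} := by
  classical
  have hm : Measurable ((Metric.ball 0 r).piecewise θ fun _ => 0) :=
    ContinuousOn.measurable_piecewise
      (fun w hw => (h.contDiffAt w hw).continuousAt.continuousWithinAt) continuousOn_const
      Metric.isOpen_ball.measurableSet
  have hin : Measurable fun w : Euc (m + 1) => inner ℝ u w := by fun_prop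
  have hset : {w | w ∈ Metric.ball 0 r ∧ inner ℝ u w = 0 ∧ θ w ∈ B} =
      Metric.ball 0 r ∩ ((fun w => inner ℝ u w) ⁻¹' {0} ∩
        ((Metric.ball 0 r).piecewise θ fun _ => 0) ⁻¹' B) := by
    ext w
    by_cases hw : w ∈ Metric.ball 0 r
    · simp [hw, -Metric.mem_ball]
    · simp [hw, -Metric.mem_ball]
  rw [hset]
  exact Metric.isOpen_ball.measurableSet.inter ((hin (measurableSet_singleton 0)).inter (hm hB))

/-- A signed or unsigned distance function `s` to `Γ`: along the normals of a chart it is, up to the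
choice of the orientation `σ`, a fixed function `ρ` of the arc length. -/
def IsTubeDistance (Γ : Set (Euc (m + 1))) (ε : ℝ) (s : Euc (m + 1) → ℝ) (ρ : ℝ → ℝ) : Prop :=
  ∀ p u θ N r, IsTubeChart Γ ε p u θ N r → ∃ σ : ℝ, (σ = 1 ∨ σ = -1) ∧
    ∀ z, perpProj u z ∈ Metric.ball 0 r → |inner ℝ u z| < ε →
      s (tubeMap u θ N z) = ρ (σ * inner ℝ u z)

/-- The orientation `σ` does not matter for the length, as normal segments are symmetric. -/
theorem volume_Ioo_inter_preimage_mul {σ : ℝ} (hσ : σ = 1 ∨ σ = -1) {S : Set ℝ}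
    (hS : MeasurableSet S) :
    volume (Set.Ioo (-ε) ε ∩ (fun t => σ * t) ⁻¹' S) = volume (Set.Ioo (-ε) ε ∩ S) := by
  rcases hσ with rfl | rfl
  · simp
  · have : Set.Ioo (-ε) ε ∩ (fun t => -1 * t) ⁻¹' S = Neg.neg ⁻¹' (Set.Ioo (-ε) ε ∩ S) := by
      ext t
      simp only [Set.mem_inter_iff, Set.mem_Ioo, Set.mem_preimage, neg_one_mul]
      constructor <;> rintro ⟨⟨h1, h2⟩, h3⟩ <;> exact ⟨⟨by linarith, by linarith⟩, h3⟩
    rw [this, (Measure.measurePreserving_neg (volume : Measure ℝ)).measure_preimage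
      (measurableSet_Ioo.inter hS).nullMeasurableSet]

/-- Near each interior point of `Γ`, the area of subsets of `Γ` is finite, and it is comparable, up
to constants arbitrarily close to `1`, to the integral of the singular product over the part of the
tube above. -/
theorem exists_nhds_area_comparison (htube : HasNormalTube Γ ε)
    (hκ : ∀ p κ, IsPrincipalCurvature Γ p κ → ε * |κ| < 1) (hP : IsClosestPointMap Γ P)
    {s : Euc (m + 1) → ℝ} {ρ : ℝ → ℝ} (hs : IsTubeDistance Γ ε s ρ) (hρ : Measurable ρ)
    (hp : IsInteriorPoint Γ p) {K : NNReal} (hK : 1 < K) :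
    ∃ V ∈ 𝓝 p, μHE[m] ({p | IsInteriorPoint Γ p} ∩ V) < ⊤ ∧
      ∀ B ⊆ V, MeasurableSet B → ∀ C : Set ℝ, MeasurableSet C →
        ∫⁻ x in interiorTube Γ ε P ∩ {x | P x ∈ B ∧ s x ∈ C}, ENNReal.ofReal (singularProduct P x) ≤
          K * (μHE[m] ({p | IsInteriorPoint Γ p} ∩ B) * volume (Set.Ioo (-ε) ε ∩ ρ ⁻¹' C)) ∧
        μHE[m] ({p | IsInteriorPoint Γ p} ∩ B) * volume (Set.Ioo (-ε) ε ∩ ρ ⁻¹' C) ≤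
          (K : ENNReal) ^ (m + 1) * ∫⁻ x in interiorTube Γ ε P ∩ {x | P x ∈ B ∧ s x ∈ C},
            ENNReal.ofReal (singularProduct P x) := by
  obtain ⟨u, θ, N, r₀, -, h₀⟩ := exists_isTubeChart hp hκ one_pos
  have hK0 : (0 : ℝ) < K := by positivity
  -- a smaller chart on which the parametrization is `K`-Lipschitz with area element close to `1`
  obtain ⟨r, hr, hlip, hdet⟩ : ∃ r, IsTubeChart Γ ε p u θ N r ∧
      LipschitzOnWith K θ (Metric.ball 0 r) ∧ ∀ w ∈ Metric.ball (0 : Euc (m + 1)) r,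
        |(tubeFrame u θ N w).det| < K ∧ (K : ℝ)⁻¹ < |(tubeFrame u θ N w).det| := by
    have hst : HasStrictFDerivAt θ (ContinuousLinearMap.id ℝ (Euc (m + 1))) 0 :=
      (h₀.contDiffAt 0 (Metric.mem_ball_self h₀.pos)).hasStrictFDerivAt' h₀.hasFDerivAt_zero
        (by norm_num)
    obtain ⟨S, hS, hlip⟩ := hst.exists_lipschitzOnWith_of_nnnorm_lt K
      (lt_of_le_of_lt ContinuousLinearMap.norm_id_le hK)
    have hc : ContinuousAt (fun w => |(tubeFrame u θ N w).det|) 0 :=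
      (ContinuousLinearMap.continuous_det.continuousAt.comp h₀.continuousAt_tubeFrame).abs
    have h1 : |(tubeFrame u θ N 0).det| = 1 := by
      rw [h₀.tubeFrame_zero]
      simp [ContinuousLinearMap.det]
    have hK1 : (1 : ℝ) < K := hK
    have h2 := hc.eventually (gt_mem_nhds (show |(tubeFrame u θ N 0).det| < K by rwa [h1]))
    have h3 := hc.eventually (lt_mem_nhds (show (K : ℝ)⁻¹ < |(tubeFrame u θ N 0).det| by
      rw [h1]; exact inv_lt_one_of_one_lt₀ hK1))
    obtain ⟨r₁, hr₁, hb⟩ := Metric.eventually_nhds_iff_ball.1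
      ((show ∀ᶠ w in 𝓝 (0 : Euc (m + 1)), w ∈ S from hS).and (h2.and h3))
    refine ⟨min r₀ r₁, h₀.mono (lt_min h₀.pos hr₁) (min_le_left _ _), ?_, ?_⟩
    · exact hlip.mono fun w hw => (hb w (Metric.ball_subset_ball (min_le_right _ _) hw)).1
    · exact fun w hw => (hb w (Metric.ball_subset_ball (min_le_right _ _) hw)).2
  clear h₀
  set Γi := {p | IsInteriorPoint Γ p} with hΓi
  set V : Set (Euc (m + 1)) := {q | q ∈ Γ →
    perpProj u (q - p) ∈ Metric.ball 0 r ∧ θ (perpProj u (q - p)) = q} with hV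
  have hVp : V ∈ 𝓝 p := hr.cover
  have himage : ∀ B ⊆ V, Γi ∩ B = θ '' {w | w ∈ Metric.ball 0 r ∧ inner ℝ u w = 0 ∧ θ w ∈ B} := by
    intro B hBV
    ext q
    constructor
    · rintro ⟨hqi, hqB⟩
      obtain ⟨h1, h2⟩ := hBV hqB hqi.1
      exact ⟨_, ⟨h1, inner_perpProj hr.norm_u _, by rwa [h2]⟩, h2⟩
    · rintro ⟨w, ⟨hw, hwu, hwB⟩, rfl⟩
      exact ⟨hr.interior w hw hwu, hwB⟩
  have hlipA : ∀ B : Set (Euc (m + 1)),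
      μHE[m] (θ '' {w | w ∈ Metric.ball 0 r ∧ inner ℝ u w = 0 ∧ θ w ∈ B}) ≤
      (K : ENNReal) ^ m * μHE[m] {w | w ∈ Metric.ball 0 r ∧ inner ℝ u w = 0 ∧ θ w ∈ B} := fun B =>
    LipschitzOnWith.euclideanHausdorffMeasure_image_le
      (s := {w | w ∈ Metric.ball 0 r ∧ inner ℝ u w = 0 ∧ θ w ∈ B}) (hlip.mono fun w hw => hw.1) m
  refine ⟨V, hVp, ?_, fun B hBV hB C hC => ?_⟩
  · rw [himage V subset_rfl]
    have hsub : {w | w ∈ Metric.ball 0 r ∧ inner ℝ u w = 0 ∧ θ w ∈ V} ⊆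
        {w | w ∈ Metric.ball 0 r ∧ inner ℝ u w = 0 ∧ θ w ∈ Set.univ} :=
      fun w hw => ⟨hw.1, hw.2.1, trivial⟩
    refine (measure_mono (Set.image_mono hsub)).trans_lt ((hlipA _).trans_lt ?_)
    refine ENNReal.mul_lt_top (ENNReal.pow_lt_top ENNReal.coe_lt_top) ?_
    have hcyl := volume_cylinder hr.norm_u (hr.measurableSet_base MeasurableSet.univ)
      (fun a ha => ha.2.1) (measurableSet_Ioo (a := (0 : ℝ)) (b := 1))
    rw [Real.volume_Ioo, sub_zero, ENNReal.ofReal_one, mul_one] at hcyl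
    rw [← hcyl]
    refine (measure_mono (t := Metric.ball (0 : Euc (m + 1)) (r + 1)) fun z hz => ?_).trans_lt
      Metric.isBounded_ball.measure_lt_top
    have h1 := hz.1.1
    rw [mem_ball_zero_iff] at h1 ⊢
    have h2 : ‖inner ℝ u z • u‖ ≤ 1 := by
      rw [norm_smul, hr.norm_u, mul_one, Real.norm_eq_abs, abs_of_pos hz.2.1]
      exact hz.2.2.le
    have h3 := norm_add_le (perpProj u z) (inner ℝ u z • u)
    rw [perpProj_add] at h3
    linarith
  obtain ⟨σ, hσ, hsσ⟩ := hs p u θ N r hr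
  set A : Set (Euc (m + 1)) := {w | w ∈ Metric.ball 0 r ∧ inner ℝ u w = 0 ∧ θ w ∈ B} with hA
  have hAm : MeasurableSet A := hr.measurableSet_base hB
  set C' : Set ℝ := Set.Ioo (-ε) ε ∩ (fun t => σ * t) ⁻¹' (ρ ⁻¹' C) with hC'
  have hC'm : MeasurableSet C' :=
    measurableSet_Ioo.inter ((measurable_const_mul σ) (hρ hC))
  have hC'v : volume C' = volume (Set.Ioo (-ε) ε ∩ ρ ⁻¹' C) :=
    volume_Ioo_inter_preimage_mul hσ (hρ hC)
  set S : Set (Euc (m + 1)) := {z | perpProj u z ∈ A ∧ inner ℝ u z ∈ C'} with hS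
  have hSm : MeasurableSet S :=
    ((perpProj u).continuous.measurable hAm).inter
      ((show Measurable fun z : Euc (m + 1) => inner ℝ u z by fun_prop) hC'm)
  have hSv : volume S = μHE[m] A * volume (Set.Ioo (-ε) ε ∩ ρ ⁻¹' C) := by
    rw [hS, volume_cylinder hr.norm_u hAm (fun a ha => ha.2.1) hC'm, hC'v]
  have habs : ∀ z ∈ S, |inner ℝ u z| < ε := fun z hz => abs_lt.2 hz.2.1
  have hΨS : interiorTube Γ ε P ∩ {x | P x ∈ B ∧ s x ∈ C} = tubeMap u θ N '' S := by
    ext x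
    constructor
    · rintro ⟨⟨hxd, hxi⟩, hxB, hxC⟩
      obtain ⟨h1, h2⟩ := hBV hxB hxi.1
      obtain ⟨z, hz, rfl, hzd⟩ := hr.exists_tubeMap_eq hP h1 (inner_perpProj hr.norm_u _) h2.symm
      rw [← hzd] at hxd
      rw [← hz] at h1 h2
      refine ⟨z, ⟨⟨h1, inner_perpProj hr.norm_u _, by rwa [h2]⟩, abs_lt.1 hxd, ?_⟩, rfl⟩
      rw [Set.mem_preimage, Set.mem_preimage, ← hsσ z h1 hxd]
      exact hxC
    · rintro ⟨z, hz, rfl⟩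
      have h1 := hr.closestPoint_tubeMap htube hP hz.1.1 (habs z hz)
      refine ⟨⟨?_, ?_⟩, ?_, ?_⟩
      · rw [hr.infDist_tubeMap htube hz.1.1 (habs z hz)]; exact habs z hz
      · rw [h1]; exact hr.interior _ hz.1.1 hz.1.2.1
      · rw [h1]; exact hz.1.2.2
      · rw [hsσ z hz.1.1 (habs z hz)]; exact hz.2.2
  have hinj : Set.InjOn (tubeMap u θ N) S := by
    intro z hz y hy hzy
    have h1 : θ (perpProj u z) = θ (perpProj u y) := by
      rw [← hr.closestPoint_tubeMap htube hP hz.1.1 (habs z hz),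
        ← hr.closestPoint_tubeMap htube hP hy.1.1 (habs y hy), hzy]
    have h2 : perpProj u z = perpProj u y := by
      rw [← hr.proj _ hz.1.1 hz.1.2.1, h1, hr.proj _ hy.1.1 hy.1.2.1]
    have h3 : inner ℝ u z • N (perpProj u z) = inner ℝ u y • N (perpProj u z) := by
      rw [tubeMap, tubeMap, ← h2] at hzy
      exact add_left_cancel hzy
    have h4 : N (perpProj u z) ≠ 0 := by
      rw [← norm_ne_zero_iff, hr.norm_normal _ hz.1.1]; exact one_ne_zero
    have h5 := smul_left_injective ℝ h4 h3
    rw [← perpProj_add u z, ← perpProj_add u y, h2, show inner ℝ u z = inner ℝ u y from h5]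
  have hint : ∫⁻ x in interiorTube Γ ε P ∩ {x | P x ∈ B ∧ s x ∈ C},
      ENNReal.ofReal (singularProduct P x) =
      ∫⁻ z in S, ENNReal.ofReal |(tubeFrame u θ N (perpProj u z)).det| := by
    rw [hΨS, lintegral_image_eq_lintegral_abs_det_fderiv_mul volume hSm
      (fun z hz => (hr.hasFDerivAt_tubeMap hz.1.1).hasFDerivWithinAt) hinj]
    refine setLIntegral_congr_fun hSm fun z hz => ?_
    have hmem : tubeMap u θ N z ∈ interiorTube Γ ε P ∩ {x | P x ∈ B ∧ s x ∈ C} := by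
      rw [hΨS]; exact ⟨z, hz, rfl⟩
    rw [← ENNReal.ofReal_mul (abs_nonneg _), hr.singularProduct_mul_abs_det htube hP hz.1.1
      (habs z hz) (differentiableAt_closestPoint htube hκ hP hmem.1.2 hmem.1.1)]
  -- the projection to the tangent plane is a contracting left inverse of the parametrization
  have hAle : μHE[m] A ≤ μHE[m] (θ '' A) := by
    have hl : LipschitzWith 1 fun q => perpProj u (q - p) := by
      refine LipschitzWith.of_dist_le_mul fun x y => ?_
      rw [dist_eq_norm, dist_eq_norm, ← map_sub, sub_sub_sub_cancel_right, NNReal.coe_one, one_mul]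
      exact norm_perpProj_le hr.norm_u _
    have h1 : (fun q => perpProj u (q - p)) '' (θ '' A) = A := by
      rw [Set.image_image]
      refine (Set.image_congr fun w hw => hr.proj w hw.1 hw.2.1).trans (Set.image_id' A)
    have h2 := (hl.lipschitzOnWith (s := θ '' A)).euclideanHausdorffMeasure_image_le m
    rwa [h1, ENNReal.coe_one, one_pow, one_mul] at h2
  rw [hint, himage B hBV]
  constructor
  · calc ∫⁻ z in S, ENNReal.ofReal |(tubeFrame u θ N (perpProj u z)).det|
        ≤ ∫⁻ _ in S, (K : ENNReal) := by
          refine setLIntegral_mono' hSm fun z hz => ?_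
          rw [← ENNReal.ofReal_coe_nnreal]
          exact ENNReal.ofReal_le_ofReal (hdet _ hz.1.1).1.le
      _ = K * (μHE[m] A * volume (Set.Ioo (-ε) ε ∩ ρ ⁻¹' C)) := by
          rw [setLIntegral_const, hSv]
      _ ≤ _ := by gcongr
  · have hlow : (K : ENNReal)⁻¹ * volume S ≤
        ∫⁻ z in S, ENNReal.ofReal |(tubeFrame u θ N (perpProj u z)).det| := by
      rw [← setLIntegral_const]
      refine setLIntegral_mono' hSm fun z hz => ?_
      rw [← ENNReal.ofReal_coe_nnreal, ← ENNReal.ofReal_inv_of_pos hK0]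
      exact ENNReal.ofReal_le_ofReal (hdet _ hz.1.1).2.le
    have hKne : (K : ENNReal) ≠ 0 := by simpa using (zero_lt_one.trans hK).ne'
    calc μHE[m] (θ '' A) * volume (Set.Ioo (-ε) ε ∩ ρ ⁻¹' C)
        ≤ (K : ENNReal) ^ m * μHE[m] A * volume (Set.Ioo (-ε) ε ∩ ρ ⁻¹' C) := by
          gcongr; exact hlipA B
      _ = (K : ENNReal) ^ m * (K * (K : ENNReal)⁻¹) * volume S := by
          rw [ENNReal.mul_inv_cancel hKne ENNReal.coe_ne_top, hSv, mul_one, mul_assoc]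
      _ = (K : ENNReal) ^ (m + 1) * ((K : ENNReal)⁻¹ * volume S) := by ring
      _ ≤ _ := by gcongr

end Area

/-! ### The integral formula -/

section Product

variable {m : ℕ} {Γ : Set (Euc (m + 1))} {ε : ℝ} {P : Euc (m + 1) → Euc (m + 1)}
  {s : Euc (m + 1) → ℝ} {ρ : ℝ → ℝ}

theorem measurableSet_isInteriorPoint (hΓ : IsCompact Γ) :
    MeasurableSet {p | IsInteriorPoint Γ p} := by
  obtain ⟨O, hO, h⟩ := exists_isOpen_inter_eq_interior Γ
  rw [h]
  exact hΓ.isClosed.measurableSet.inter hO.measurableSet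

theorem isTubeDistance_infDist (htube : HasNormalTube Γ ε) :
    IsTubeDistance Γ ε (fun x => Metric.infDist x Γ) fun t => |t| :=
  fun _ _ _ _ _ h => ⟨1, Or.inl rfl, fun _ hz ht => by
    rw [one_mul]; exact h.infDist_tubeMap htube hz ht⟩

/-- The area of the interior of `Γ` is `σ`-finite. -/
theorem sigmaFinite_restrict_isInteriorPoint (hΓ : IsCompact Γ) (htube : HasNormalTube Γ ε)
    (hκ : ∀ p κ, IsPrincipalCurvature Γ p κ → ε * |κ| < 1) (hP : IsClosestPointMap Γ P) :
    SigmaFinite (μHE[m].restrict {p | IsInteriorPoint Γ p}) := by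
  have hΓim := measurableSet_isInteriorPoint hΓ
  refine sigmaFinite_of_locally_finite (s := {p | IsInteriorPoint Γ p}) ?_ fun p hp => ?_
  · rw [Measure.restrict_apply hΓim.compl]; simp
  · obtain ⟨V, hV, hVf, -⟩ := exists_nhds_area_comparison htube hκ hP
      (isTubeDistance_infDist htube) continuous_abs.measurable hp (K := 2) (by norm_num)
    refine ⟨V, hV, ?_⟩
    rwa [Measure.restrict_apply' hΓim, Set.inter_comm]

/-- The tube is, with the singular product as density, a product: the closest point and the
distance are distributed like the area of `Γ` times the length of the normal segments. -/
theorem map_closestPoint_distance_eq_prod (hΓ : IsCompact Γ) (htube : HasNormalTube Γ ε)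
    (hκ : ∀ p κ, IsPrincipalCurvature Γ p κ → ε * |κ| < 1) (hP : IsClosestPointMap Γ P)
    (hs : IsTubeDistance Γ ε s ρ) (hsm : Measurable s) (hρ : Measurable ρ) :
    AEMeasurable (fun x => (P x, s x)) ((volume.restrict (interiorTube Γ ε P)).withDensity
      fun x => ENNReal.ofReal (singularProduct P x)) ∧
    ((volume.restrict (interiorTube Γ ε P)).withDensity
      fun x => ENNReal.ofReal (singularProduct P x)).map (fun x => (P x, s x)) =
      (μHE[m].restrict {p | IsInteriorPoint Γ p}).prod
        ((volume.restrict (Set.Ioo (-ε) ε)).map ρ) := by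
  set U := interiorTube Γ ε P with hU
  set τ := (volume.restrict U).withDensity fun x => ENNReal.ofReal (singularProduct P x) with hτ
  set Γi := {p | IsInteriorPoint Γ p} with hΓi
  have hUm : MeasurableSet U := (isOpen_interiorTube htube hκ hP).measurableSet
  have hΓim : MeasurableSet Γi := measurableSet_isInteriorPoint hΓ
  have hae : AEMeasurable (fun x => (P x, s x)) τ :=
    (((continuousOn_closestPoint htube hκ hP).aemeasurable hUm).prodMk hsm.aemeasurable).mono_ac
      (withDensity_absolutelyContinuous _ _)
  refine ⟨hae, ?_⟩
  have hrect : ∀ B C, MeasurableSet B → MeasurableSet C →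
      τ.map (fun x => (P x, s x)) (B ×ˢ C) =
        ∫⁻ x in U ∩ {x | P x ∈ B ∧ s x ∈ C}, ENNReal.ofReal (singularProduct P x) := by
    intro B C hB hC
    rw [Measure.map_apply_of_aemeasurable hae (hB.prod hC), hτ, withDensity_apply',
      Measure.restrict_restrict' hUm, Set.inter_comm]
    rfl
  have hlam : ∀ C, MeasurableSet C → (volume.restrict (Set.Ioo (-ε) ε)).map ρ C =
      volume (Set.Ioo (-ε) ε ∩ ρ ⁻¹' C) := by
    intro C hC
    rw [Measure.map_apply hρ hC, Measure.restrict_apply (hρ hC), Set.inter_comm]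
  have hΓic : μHE[m].restrict Γi Γiᶜ = 0 := by
    rw [Measure.restrict_apply hΓim.compl]; simp
  have hsf := sigmaFinite_restrict_isInteriorPoint hΓ htube hκ hP
  have hsf' : IsFiniteMeasure ((volume.restrict (Set.Ioo (-ε) ε)).map ρ) := inferInstance
  symm
  refine Measure.prod_eq fun B C hB hC => ?_
  -- for fixed `C` both sides are measures in `B`
  set Q := ((τ.map fun x => (P x, s x)).restrict (Set.univ ×ˢ C)).map Prod.fst with hQ
  have hQa : ∀ B, MeasurableSet B → Q B =
      ∫⁻ x in U ∩ {x | P x ∈ B ∧ s x ∈ C}, ENNReal.ofReal (singularProduct P x) := by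
    intro B hB
    rw [hQ, Measure.map_apply measurable_fst hB, Measure.restrict_apply (measurable_fst hB),
      ← hrect B C hB hC]
    congr 1
    ext ⟨a, b⟩
    simp
  set R := volume (Set.Ioo (-ε) ε ∩ ρ ⁻¹' C) • μHE[m].restrict Γi with hR
  have hRa : ∀ B, MeasurableSet B → R B =
      μHE[m] (Γi ∩ B) * volume (Set.Ioo (-ε) ε ∩ ρ ⁻¹' C) := by
    intro B hB
    rw [hR, Measure.smul_apply, Measure.restrict_apply hB, smul_eq_mul, mul_comm, Set.inter_comm]
  have hQc : Q Γiᶜ = 0 := by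
    rw [hQa _ hΓim.compl]
    have : U ∩ {x | P x ∈ Γiᶜ ∧ s x ∈ C} = ∅ := by
      ext x
      simp only [Set.mem_inter_iff, Set.mem_empty_iff_false, iff_false, not_and]
      exact fun hx hx' => hx'.1 hx.2
    rw [this, setLIntegral_empty]
  have hRc : R Γiᶜ = 0 := by
    rw [hR, Measure.smul_apply, hΓic, smul_zero]
  have hQR : Q B = R B := by
    apply le_antisymm
    · refine ENNReal.le_of_forall_one_lt_le_pow_mul 1 fun K hK => ?_
      rw [pow_one]
      refine Measure.le_mul_of_locally_le hQc (fun p hp => ?_) hB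
      obtain ⟨V, hV, -, h⟩ := exists_nhds_area_comparison htube hκ hP hs hρ hp hK
      refine ⟨V, hV, fun B hBV hB => ?_⟩
      rw [hQa B hB, hRa B hB]
      exact (h B hBV hB C hC).1
    · refine ENNReal.le_of_forall_one_lt_le_pow_mul (m + 1) fun K hK => ?_
      refine Measure.le_mul_of_locally_le hRc (fun p hp => ?_) hB
      obtain ⟨V, hV, -, h⟩ := exists_nhds_area_comparison htube hκ hP hs hρ hp hK
      refine ⟨V, hV, fun B hBV hB => ?_⟩
      rw [hQa B hB, hRa B hB]
      exact (h B hBV hB C hC).2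
  rw [hrect B C hB hC, ← hQa B hB, hQR, hRa B hB, Measure.restrict_apply hB, hlam C hC,
    Set.inter_comm]

/-- The points at distance exactly `ε` above the interior of `Γ` lie on parallel surfaces and form
a null set. -/
theorem volume_infDist_eq_inter_eq_zero
    (hκ : ∀ p κ, IsPrincipalCurvature Γ p κ → ε * |κ| < 1) (hP : IsClosestPointMap Γ P) :
    volume {x | Metric.infDist x Γ = ε ∧ IsInteriorPoint Γ (P x)} = 0 := by
  have hloc : ∀ p ∈ {p | IsInteriorPoint Γ p}, ∃ V ∈ 𝓝 p,
      volume {x | Metric.infDist x Γ = ε ∧ P x ∈ V} = 0 := by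
    intro p hp
    obtain ⟨u, θ, N, r, -, h⟩ := exists_isTubeChart hp hκ one_pos
    refine ⟨_, h.cover, ?_⟩
    set S : Set (Euc (m + 1)) := {z | perpProj u z ∈ Metric.ball 0 r ∧ |inner ℝ u z| = ε}
    have hS : volume S = 0 := by
      have hin : Measurable fun w : Euc (m + 1) => inner ℝ u w := by fun_prop
      have h1 := volume_cylinder (A := (fun w => inner ℝ u w) ⁻¹' {0}) h.norm_u
        (hin (measurableSet_singleton 0)) (fun a ha => ha)
        ((Set.toFinite {ε, -ε}).measurableSet)
      rw [(Set.toFinite {ε, -ε}).measure_zero, mul_zero] at h1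
      refine measure_mono_null ?_ h1
      intro z hz
      refine ⟨inner_perpProj h.norm_u z, ?_⟩
      have := eq_or_eq_neg_of_abs_eq hz.2
      simpa using this
    refine measure_mono_null ?_ (addHaar_image_eq_zero_of_differentiableOn_of_addHaar_eq_zero
      (f := tubeMap u θ N) volume (fun z hz => ?_) hS)
    · rintro x ⟨hx, hxV⟩
      obtain ⟨h1, h2⟩ := hxV (hP x).1
      obtain ⟨z, hz, hzx, hzd⟩ := h.exists_tubeMap_eq hP h1 (inner_perpProj h.norm_u _) h2.symm
      exact ⟨z, ⟨by rwa [hz], hzd.trans hx⟩, hzx⟩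
    · exact (h.hasFDerivAt_tubeMap hz.1).differentiableAt.differentiableWithinAt
  choose! V hV hV0 using hloc
  obtain ⟨t, hts, htc, hcov⟩ := TopologicalSpace.countable_cover_nhdsWithin
    (s := {p | IsInteriorPoint Γ p}) (f := V) fun x hx => mem_nhdsWithin_of_mem_nhds (hV x hx)
  refine measure_mono_null (t := ⋃ p ∈ t, {x | Metric.infDist x Γ = ε ∧ P x ∈ V p}) ?_
    ((measure_biUnion_null_iff htc).2 fun p hp => hV0 p (hts hp))
  rintro x ⟨hx, hxi⟩
  obtain ⟨p, hp, hxp⟩ := Set.mem_iUnion₂.1 (hcov hxi)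
  exact Set.mem_iUnion₂.2 ⟨p, hp, hx, hxp⟩

theorem IsAveragingKernel.setIntegral_Ioo {K : ℝ → ℝ} (hK : IsAveragingKernel K ε) :
    ∫ t in Set.Ioo (-ε) ε, K t = 1 := by
  rw [← integral_Icc_eq_integral_Ioo, setIntegral_eq_integral_of_forall_compl_eq_zero,
    hK.integral_eq_one]
  intro t ht
  apply hK.support
  rw [Set.mem_Icc, ← abs_le] at ht
  exact not_le.1 ht

/-- The integral formula for any function `s` that measures the distance along the normals. -/
theorem integrable_and_integral_eq (hm : 1 ≤ m) (hΓ : IsCompactC2Hypersurface Γ)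
    (htube : HasNormalTube Γ ε)
    (hκ : ∀ p κ, IsPrincipalCurvature Γ p κ → ε * |κ| < 1) (hP : IsClosestPointMap Γ P)
    (hs : IsTubeDistance Γ ε s ρ) (hsm : Measurable s)
    (hsΓ : ∀ x, |s x| = Metric.infDist x Γ)
    (hρ : Measure.QuasiMeasurePreserving ρ volume volume) {K : ℝ → ℝ} (hK : IsAveragingKernel K ε)
    (hKρ : ∀ t, K (ρ t) = K t) {v : Euc (m + 1) → ℝ} (hv : IntegrableOn v Γ μHE[m]) :
    Integrable (fun x => v (P x) * K (s x) * singularProduct P x) ∧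
      ∫ x in Γ, v x ∂μHE[m] = ∫ x, v (P x) * K (s x) * singularProduct P x := by
  set U := interiorTube Γ ε P with hU
  set Γi := {p | IsInteriorPoint Γ p} with hΓi
  set lam := (volume.restrict (Set.Ioo (-ε) ε)).map ρ with hlam
  have hsf := sigmaFinite_restrict_isInteriorPoint hΓ.1 htube hκ hP
  obtain ⟨hae, hmap⟩ := map_closestPoint_distance_eq_prod hΓ.1 htube hκ hP hs hsm hρ.measurable
  have hUm : MeasurableSet U := (isOpen_interiorTube htube hκ hP).measurableSet
  have hΓi_ae : Γi =ᵐ[μHE[m]] Γ := by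
    have hsub : Γi ≤ Γ := fun p hp => hp.1
    refine hsub.eventuallyLE.antisymm ?_
    exact ae_le_set.2 (measure_diff_interior_eq_zero hΓ)
  have hsing : AEMeasurable (fun x => ENNReal.ofReal (singularProduct P x)) (volume.restrict U) :=
    (ContinuousOn.aemeasurable (fun x hx =>
      (continuousAt_singularProduct htube hκ hP hx).continuousWithinAt) hUm).ennreal_ofReal
  have hsing0 : ∀ x, 0 ≤ singularProduct P x := fun x =>
    Finset.prod_nonneg fun j _ => LinearMap.singularValues_nonneg _ j
  have hvi : Integrable v (μHE[m].restrict Γi) := hv.mono_set fun p hp => hp.1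
  have hKac : AEStronglyMeasurable K lam := by
    refine hK.integrable.aestronglyMeasurable.mono_ac ?_
    exact (Measure.absolutelyContinuous_of_le (Measure.map_mono Measure.restrict_le_self
      hρ.measurable)).trans hρ.absolutelyContinuous
  have hKi : Integrable K lam := by
    rw [hlam, integrable_map_measure hKac hρ.measurable.aemeasurable]
    have : K ∘ ρ = K := funext hKρ
    rw [this]
    exact hK.integrable.restrict
  have hK1 : ∫ t, K t ∂lam = 1 := by
    rw [hlam, integral_map hρ.measurable.aemeasurable hKac]
    simp_rw [hKρ]
    exact hK.setIntegral_Ioo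
  have hprod := hvi.mul_prod hKi
  rw [← hmap] at hprod
  have hint1 := (integrable_map_measure hprod.aestronglyMeasurable hae).1 hprod
  have hval : ∫ x in Γ, v x ∂μHE[m] = ∫ x, v (P x) * K (s x) ∂((volume.restrict U).withDensity
      fun x => ENNReal.ofReal (singularProduct P x)) := by
    rw [← integral_map (f := fun z : Euc (m + 1) × ℝ => v z.1 * K z.2) hae
      hprod.aestronglyMeasurable, hmap, integral_prod_mul, hK1, mul_one,
      setIntegral_congr_set hΓi_ae]
  have hfin : ∀ᵐ x ∂(volume.restrict U), ENNReal.ofReal (singularProduct P x) < ⊤ :=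
    Eventually.of_forall fun x => ENNReal.ofReal_lt_top
  have heq : ∀ x, (ENNReal.ofReal (singularProduct P x)).toReal • (v (P x) * K (s x)) =
      v (P x) * K (s x) * singularProduct P x := fun x => by
    rw [ENNReal.toReal_ofReal (hsing0 x), smul_eq_mul, mul_comm]
  -- outside the tube over the interior the integrand vanishes almost everywhere
  have hzero : ∀ᵐ x, x ∉ U → v (P x) * K (s x) * singularProduct P x = 0 := by
    have h0 : ∀ᵐ x, ¬(Metric.infDist x Γ = ε ∧ IsInteriorPoint Γ (P x)) :=
      measure_eq_zero_iff_ae_notMem.1 (volume_infDist_eq_inter_eq_zero hκ hP)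
    filter_upwards [h0] with x hx hxU
    by_cases hxi : IsInteriorPoint Γ (P x)
    · have h1 : ε < |s x| := by
        rw [hsΓ]
        refine lt_of_le_of_ne (not_lt.1 fun h => hxU ⟨h, hxi⟩) fun h => hx ⟨h.symm, hxi⟩
      rw [hK.support _ h1, mul_zero, zero_mul]
    · rw [singularProduct_eq_zero_of_mem_boundary hm (fun y => (hP y).1)
        ((hΓ.2 _ (hP x).1).resolve_left hxi), mul_zero]
  have hint2 : IntegrableOn (fun x => v (P x) * K (s x) * singularProduct P x) U := by
    have := (integrable_withDensity_iff_integrable_smul₀' hsing hfin).1 hint1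
    exact (integrable_congr (Eventually.of_forall heq)).1 this
  refine ⟨?_, ?_⟩
  · exact hint2.integrable_of_ae_notMem_eq_zero hzero
  · rw [hval, integral_withDensity_eq_integral_toReal_smul₀ hsing hfin]
    simp_rw [heq]
    exact setIntegral_eq_integral_of_ae_compl_eq_zero hzero

end Product

/-! ### The signed distance -/

section Distances

variable {m : ℕ} {Γ Ω : Set (Euc (m + 1))} {ε : ℝ}

theorem quasiMeasurePreserving_abs :
    Measure.QuasiMeasurePreserving (fun t : ℝ => |t|) volume volume := by
  refine ⟨continuous_abs.measurable, Measure.AbsolutelyContinuous.mk fun S hS h0 => ?_⟩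
  rw [Measure.map_apply continuous_abs.measurable hS]
  have h1 : volume (Neg.neg ⁻¹' S) = 0 := by
    rwa [(Measure.measurePreserving_neg (volume : Measure ℝ)).measure_preimage hS.nullMeasurableSet]
  refine measure_mono_null (fun t ht => ?_) (measure_union_null h0 h1)
  rcases abs_choice t with h | h
  · left; rwa [Set.mem_preimage, h] at ht
  · right; rwa [Set.mem_preimage, h] at ht

/-- The signed distance is a distance to the boundary: a segment from a point of `Ω` to a nearest
point of the complement ends in the boundary, and likewise from outside. -/
theorem abs_domainSignedDist (hΩ : IsOpen Ω) (hΓ : frontier Ω = Γ) (hne : Γ.Nonempty)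
    (x : Euc (m + 1)) : |domainSignedDist Ω x| = Metric.infDist x Γ := by
  have hΓc : Γ ⊆ Ωᶜ := by
    rw [← hΓ, hΩ.frontier_eq]; exact fun y hy => hy.2
  have hΓcl : Γ ⊆ closure Ω := by rw [← hΓ]; exact frontier_subset_closure
  unfold domainSignedDist
  split_ifs with hx
  · rw [abs_of_nonneg Metric.infDist_nonneg]
    refine le_antisymm (Metric.infDist_le_infDist_of_subset hΓc hne) ?_
    have hnu : Ω ≠ Set.univ := by
      rintro rfl
      obtain ⟨y, hy⟩ := hne
      exact hΓc hy trivial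
    obtain ⟨y, hy, hxy⟩ := exists_mem_frontier_infDist_compl_eq_dist hx hnu
    rw [hxy]
    exact Metric.infDist_le_dist_of_mem (hΓ ▸ hy)
  · rw [abs_neg, abs_of_nonneg Metric.infDist_nonneg, ← Metric.infDist_closure]
    refine le_antisymm (Metric.infDist_le_infDist_of_subset hΓcl hne) ?_
    by_cases hxc : x ∈ closure Ω
    · have : x ∈ Γ := by rw [← hΓ, hΩ.frontier_eq]; exact ⟨hxc, hx⟩
      rw [Metric.infDist_zero_of_mem this]
      exact Metric.infDist_nonneg
    · have hnu : (closure Ω)ᶜ ≠ Set.univ := by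
        intro h
        obtain ⟨y, hy⟩ := hne
        exact (h ▸ Set.mem_univ y : y ∈ (closure Ω)ᶜ) (hΓcl hy)
      obtain ⟨y, hy, hxy⟩ := exists_mem_frontier_infDist_compl_eq_dist
        (show x ∈ (closure Ω)ᶜ from hxc) hnu
      rw [compl_compl] at hxy
      rw [hxy]
      rw [frontier_compl] at hy
      exact Metric.infDist_le_dist_of_mem (hΓ ▸ frontier_closure_subset hy)

theorem measurable_domainSignedDist (hΩ : IsOpen Ω) : Measurable (domainSignedDist Ω) := by
  classical
  unfold domainSignedDist
  convert Measurable.ite (p := fun x => x ∈ Ω) hΩ.measurableSet (f := fun x => Metric.infDist x Ωᶜ)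
    (g := fun x => -Metric.infDist x Ω) ?_ ?_
  · exact (Metric.continuous_infDist_pt _).measurable
  · exact (Metric.continuous_infDist_pt _).neg.measurable

/-- Each side of a chart lies entirely inside or entirely outside `Ω`, by connectedness; if both
sides were inside or both were outside, then the centre of the chart would not be in the boundary
of `Ω = interior (closure Ω)`. -/
theorem isTubeDistance_domainSignedDist (hε : 0 < ε) (htube : HasNormalTube Γ ε) (hΩ : IsOpen Ω)
    (hΩr : interior (closure Ω) = Ω) (hΓ : frontier Ω = Γ) (hΓc : IsCompact Γ) :
    IsTubeDistance Γ ε (domainSignedDist Ω) fun t => t := by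
  intro p u θ N r h
  have hpΓ : p ∈ Γ := by
    have := (h.interior 0 (Metric.mem_ball_self h.pos) (inner_zero_right u)).1
    rwa [h.zero] at this
  have hp : p ∈ closure Ω ∧ p ∉ Ω := by
    have : p ∈ frontier Ω := hΓ ▸ hpΓ
    rwa [hΩ.frontier_eq] at this
  have habs := abs_domainSignedDist hΩ hΓ ⟨p, hpΓ⟩
  have hΓΩ : ∀ y ∈ Γ, y ∈ closure Ω ∧ y ∉ Ω := fun y hy => by
    rw [← hΓ, hΩ.frontier_eq] at hy; exact hy
  have hmemΓ : ∀ z, perpProj u z ∈ Metric.ball 0 r → |inner ℝ u z| < ε →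
      (tubeMap u θ N z ∈ Γ ↔ inner ℝ u z = 0) := by
    intro z hz ht
    rw [hΓc.isClosed.mem_iff_infDist_zero ⟨p, hpΓ⟩, h.infDist_tubeMap htube hz ht, abs_eq_zero]
  have hside : ∀ I : Set ℝ, Convex ℝ I → (∀ t ∈ I, |t| < ε ∧ t ≠ 0) →
      tubeMap u θ N '' {z | perpProj u z ∈ Metric.ball 0 r ∧ inner ℝ u z ∈ I} ⊆ Ω ∨
      tubeMap u θ N '' {z | perpProj u z ∈ Metric.ball 0 r ∧ inner ℝ u z ∈ I} ⊆ (closure Ω)ᶜ := by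
    intro I hI hI0
    have hconv : Convex ℝ {z : Euc (m + 1) | perpProj u z ∈ Metric.ball 0 r ∧ inner ℝ u z ∈ I} :=
      ((convex_ball (0 : Euc (m + 1)) r).linear_preimage (perpProj u).toLinearMap).inter
        (hI.linear_preimage (innerSL ℝ u).toLinearMap)
    have hpre := hconv.isPreconnected.image (tubeMap u θ N) fun z hz =>
      (h.hasFDerivAt_tubeMap hz.1).continuousAt.continuousWithinAt
    refine hpre.subset_or_subset hΩ isClosed_closure.isOpen_compl
      (Set.disjoint_compl_right_iff_subset.2 subset_closure) ?_
    rintro _ ⟨z, hz, rfl⟩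
    by_contra hcon
    simp only [Set.mem_union, Set.mem_compl_iff, not_or, not_not] at hcon
    have hf : tubeMap u θ N z ∈ frontier Ω := by
      rw [hΩ.frontier_eq]; exact ⟨hcon.2, hcon.1⟩
    rw [hΓ, hmemΓ z hz.1 (hI0 _ hz.2).1] at hf
    exact (hI0 _ hz.2).2 hf
  have hpos := hside (Set.Ioo 0 ε) (convex_Ioo 0 ε) fun t ht =>
    ⟨by rw [abs_of_pos ht.1]; exact ht.2, ht.1.ne'⟩
  have hneg := hside (Set.Ioo (-ε) 0) (convex_Ioo _ 0) fun t ht =>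
    ⟨by rw [abs_of_neg ht.2]; linarith [ht.1], ht.2.ne⟩
  have hin : ∀ z, perpProj u z ∈ Metric.ball 0 r → |inner ℝ u z| < ε → tubeMap u θ N z ∈ Ω →
      domainSignedDist Ω (tubeMap u θ N z) = |inner ℝ u z| := by
    intro z hz ht hzΩ
    rw [← h.infDist_tubeMap htube hz ht, ← habs, abs_of_nonneg]
    rw [domainSignedDist, if_pos hzΩ]
    exact Metric.infDist_nonneg
  have hout : ∀ z, perpProj u z ∈ Metric.ball 0 r → |inner ℝ u z| < ε → tubeMap u θ N z ∉ Ω →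
      domainSignedDist Ω (tubeMap u θ N z) = -|inner ℝ u z| := by
    intro z hz ht hzΩ
    rw [← h.infDist_tubeMap htube hz ht, ← habs, abs_of_nonpos, neg_neg]
    rw [domainSignedDist, if_neg hzΩ]
    exact neg_nonpos.2 Metric.infDist_nonneg
  -- a neighbourhood of the centre is covered by the two sides and by `Γ`
  have hnhds : ∀ q : Euc (m + 1) → Prop, (∀ z, perpProj u z ∈ Metric.ball 0 r → |inner ℝ u z| < ε →
      q (tubeMap u θ N z)) → ∀ᶠ x in 𝓝 p, q x := by
    intro q hq
    obtain ⟨e, he⟩ := h.exists_equiv (t := 0) (by simpa using hε)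
    have hmap := he.map_nhds_eq_of_equiv
    have hp0 : tubeMap u θ N ((0 : ℝ) • u) = p := by simp [tubeMap, h.zero]
    rw [hp0] at hmap
    rw [← hmap, eventually_map]
    filter_upwards [eventually_perpProj_mem_ball_and_abs_inner_lt (ε := ε) (h.ball_zero_mem 0)
      (by simpa using hε)] with z hz
    exact hq z hz.1 hz.2
  rcases hpos with hpos | hpos <;> rcases hneg with hneg | hneg
  · refine absurd ?_ hp.2
    rw [← hΩr, mem_interior_iff_mem_nhds]
    refine hnhds (fun x => x ∈ closure Ω) fun z hz ht => ?_
    rcases lt_trichotomy (inner ℝ u z) 0 with h0 | h0 | h0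
    · exact subset_closure (hneg ⟨z, ⟨hz, (abs_lt.1 ht).1, h0⟩, rfl⟩)
    · exact (hΓΩ _ ((hmemΓ z hz ht).2 h0)).1
    · exact subset_closure (hpos ⟨z, ⟨hz, h0, (abs_lt.1 ht).2⟩, rfl⟩)
  · refine ⟨1, Or.inl rfl, fun z hz ht => ?_⟩
    rw [one_mul]
    rcases lt_trichotomy (inner ℝ u z) 0 with h0 | h0 | h0
    · rw [hout z hz ht fun hc => hneg ⟨z, ⟨hz, (abs_lt.1 ht).1, h0⟩, rfl⟩ (subset_closure hc),
        abs_of_neg h0, neg_neg]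
    · rw [hout z hz ht (hΓΩ _ ((hmemΓ z hz ht).2 h0)).2, h0, abs_zero, neg_zero]
    · rw [hin z hz ht (hpos ⟨z, ⟨hz, h0, (abs_lt.1 ht).2⟩, rfl⟩), abs_of_pos h0]
  · refine ⟨-1, Or.inr rfl, fun z hz ht => ?_⟩
    rw [neg_one_mul]
    rcases lt_trichotomy (inner ℝ u z) 0 with h0 | h0 | h0
    · rw [hin z hz ht (hneg ⟨z, ⟨hz, (abs_lt.1 ht).1, h0⟩, rfl⟩), abs_of_neg h0]
    · rw [hout z hz ht (hΓΩ _ ((hmemΓ z hz ht).2 h0)).2, h0, abs_zero]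
    · rw [hout z hz ht fun hc => hpos ⟨z, ⟨hz, h0, (abs_lt.1 ht).2⟩, rfl⟩ (subset_closure hc),
        abs_of_pos h0]
  · have hev := hnhds (fun x => x ∉ Ω) fun z hz ht => by
      rcases lt_trichotomy (inner ℝ u z) 0 with h0 | h0 | h0
      · exact fun hc => hneg ⟨z, ⟨hz, (abs_lt.1 ht).1, h0⟩, rfl⟩ (subset_closure hc)
      · exact (hΓΩ _ ((hmemΓ z hz ht).2 h0)).2
      · exact fun hc => hpos ⟨z, ⟨hz, h0, (abs_lt.1 ht).2⟩, rfl⟩ (subset_closure hc)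
    exact absurd hev (mem_closure_iff_frequently.1 hp.1)

end Distances

theorem mainTheorem2 (n : ℕ) (hn : n = 2 ∨ n = 3)
    (Γ : Set (Euc n)) (hΓ : IsCompactC2Hypersurface Γ)
    (P : Euc n → Euc n) (hP : IsClosestPointMap Γ P)
    (ε : ℝ) (hε : 0 < ε)
    (hκ : ∀ p κ, IsPrincipalCurvature Γ p κ → ε * |κ| < 1)
    (htube : HasNormalTube Γ ε) :
    -- the integral formula
    (∀ (K : ℝ → ℝ), IsAveragingKernel K ε →
      ∀ (v : Euc n → ℝ), IntegrableOn v Γ μHE[n - 1] →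
        -- with the distance to `Γ`, for an even kernel
        ((∀ t, K (-t) = K t) →
          Integrable (fun x => v (P x) * K (Metric.infDist x Γ) * singularProduct P x) ∧
          ∫ x in Γ, v x ∂μHE[n - 1] =
            ∫ x, v (P x) * K (Metric.infDist x Γ) * singularProduct P x) ∧
        -- with the signed distance, for any kernel, if `Γ` is closed and bounds `Ω`
        (hypersurfaceBoundary Γ = ∅ →
          ∀ Ω : Set (Euc n), IsOpen Ω → interior (closure Ω) = Ω → frontier Ω = Γ →
            Integrable (fun x => v (P x) * K (domainSignedDist Ω x) * singularProduct P x) ∧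
            ∫ x in Γ, v x ∂μHE[n - 1] =
              ∫ x, v (P x) * K (domainSignedDist Ω x) * singularProduct P x)) ∧
    -- points whose closest point lies on an edge or at a corner contribute nothing
    (∀ x, P x ∈ hypersurfaceBoundary Γ → singularProduct P x = 0) ∧
    -- everywhere else in the tube, the Jacobian of `P` exists
    (∀ x, Metric.infDist x Γ < ε → P x ∉ hypersurfaceBoundary Γ → DifferentiableAt ℝ P x) := by
  obtain ⟨m, rfl, hm⟩ : ∃ m, n = m + 1 ∧ 1 ≤ m := by
    rcases hn with rfl | rfl
    · exact ⟨1, rfl, le_rfl⟩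
    · exact ⟨2, rfl, by norm_num⟩
  have hPΓ : ∀ y, P y ∈ Γ := fun y => (hP y).1
  refine ⟨fun K hK v hv => ⟨fun heven => ?_, fun _ Ω hΩ hΩr hΩΓ => ?_⟩,
    fun x hx => singularProduct_eq_zero_of_mem_boundary hm hPΓ hx,
    fun x hd hx => differentiableAt_closestPoint htube hκ hP ((hΓ.2 _ (hPΓ x)).resolve_right hx) hd⟩
  · refine integrable_and_integral_eq hm hΓ htube hκ hP (isTubeDistance_infDist htube)
      (Metric.continuous_infDist_pt Γ).measurable (fun x => abs_of_nonneg Metric.infDist_nonneg)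
      quasiMeasurePreserving_abs hK (fun t => ?_) hv
    rcases abs_choice t with h | h <;> rw [h]
    exact heven t
  · exact integrable_and_integral_eq hm hΓ htube hκ hP
      (isTubeDistance_domainSignedDist hε htube hΩ hΩr hΩΓ hΓ.1) (measurable_domainSignedDist hΩ)
      (abs_domainSignedDist hΩ hΩΓ ⟨_, hPΓ 0⟩) (Measure.QuasiMeasurePreserving.id volume) hK
      (fun _ => rfl) hv
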